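/- Let $k\ge 2$. A $k$-uniform hypergraph with loops $H$ consists of a finite set $V(H)$ and a collection $E(H)$ of $k$-element multisets of elements of $V(H)$; a labeled copy of $F$ in $H$ is an injection $V(F)\to V(H)$ that maps every edge of $F$ to an edge of $H$. Let $\pi$ be a proper partition of $k$, that is, an unordered list of $t\ge 2$ positive integers with sum $k$; an ordering of $\pi$ is a tuple $\vec\pi=(k_1,\dots,k_t)$ of its entries. Cycles. The step $S_{\vec\pi}$ has vertex set $(A\times[k_1])\sqcup(B_2\times[k_2])\sqcup\dots\sqcup(B_t\times[k_t])$, where $A=\{0,1\}^{t-1}$ and each $B_j=\{0,1\}^{t-2}$. It has one edge for each $a\in A$, namely $(\{a\}\times[k_1])\cup\bigcup_{j=1}^{t-1}(\{b_{j+1}\}\times[k_{j+1}])$, where $b_{j+1}\in B_{j+1}$ is $a$ with its $j$-th bit removed. For $\ell\ge1$, the cycle $C_{\vec\pi,4\ell}$ is formed from $2\ell$ copies of $S_{\vec\pi}$, arranged cyclically, by identifying, for every $u\in\{0,1\}^{t-2}$ and $r\in[k_1]$, the vertex $(u1,r)$ of each copy with the vertex $(u0,r)$ of the next copy. Eigenvalues.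 For an $n$-vertex $H$, let $W=\mathbb R^{V(H)}$ with standard basis $(e_v)$, and let $\tau_H$ and $J$ be the $k$-linear maps $W^k\to\mathbb R$ such that $\tau_H(e_{v_1},\dots,e_{v_k})$ is $1$ if $\{v_1,\dots,v_k\}\in E(H)$ and $0$ otherwise, and $J(e_{v_1},\dots,e_{v_k})=1$. For a $k$-linear $\sigma:W^k\to\mathbb R$, let $\sigma_{\vec\pi}:W^{\otimes k_1}\times\dots\times W^{\otimes k_t}\to\mathbb R$ be the $t$-linear map with $\sigma_{\vec\pi}(b_{1,1}\otimes\dots\otimes b_{1,k_1},\dots,b_{t,1}\otimes\dots\otimes b_{t,k_t})=\sigma(b_{1,1},\dots,b_{1,k_1},\dots,b_{t,1},\dots,b_{t,k_t})$ for standard basis vectors $b_{i,j}$ of $W$. The spectral norm of a $t$-linear map $\phi$ is $\|\phi\|=\sup\{|\phi(x_1,\dots,x_t)|:\|x_i\|=1 \text{ for all } i\}$, with Euclidean norms. Put $$\lambda_{1,\vec\pi}(H)=\|\tau_{\vec\pi}\|,\qquad \lambda_{2,\vec\pi}(H)=\Big\|\tau_{\vec\pi}-\frac{k!\,|E(H)|}{n^k}J_{\vec\pi}\Big\|,\qquad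 \tau=\tau_H.$$ Theorem. Let $0<p<1$ be fixed, let $(H_n)$ be a sequence of $k$-uniform hypergraphs with loops with $|V(H_n)|=n$ and $|E(H_n)|\ge p\binom nk$, let $\pi$ be a proper partition of $k$, and let $\ell\ge1$. Suppose that for some ordering $\vec\pi$ of $\pi$ the number of labeled copies of $C=C_{\vec\pi,4\ell}$ in $H_n$ is at most $p^{|E(C)|}n^{|V(C)|}+o(n^{|V(C)|})$. Then, for every ordering $\vec\pi'$ of $\pi$, $\lambda_{1,\vec\pi'}(H_n)=pn^{k/2}+o(n^{k/2})$ and $\lambda_{2,\vec\pi'}(H_n)=o(n^{k/2})$ as $n\to\infty$. -/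

import Mathlib

open Filter Asymptotics

/-- A `k`-uniform hypergraph with loops on the vertex set `V`: a collection of `k`-element
multisets of elements of `V`. -/
structure LoopHypergraph (V : Type*) (k : ℕ) where
  /-- the edge set; `Sym V k` is the type of multisets of elements of `V` of cardinality `k` -/
  edges : Finset (Sym V k)

/-- The `k`-element multiset `{f 0, …, f (k - 1)}`. -/
def symOfFn {V : Type*} {k : ℕ} (f : Fin k → V) : Sym V k :=
  ⟨Finset.univ.val.map f, by simp⟩

namespace LoopHypergraph

/-- The number of labeled copies of `F` in `H`: edge-preserving injections `V(F) → V(H)`. -/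
noncomputable def labeledCopies {U V : Type*} {k : ℕ}
    (F : LoopHypergraph U k) (H : LoopHypergraph V k) : ℕ :=
  Nat.card {f : U ↪ V // ∀ e ∈ F.edges, Sym.map f e ∈ H.edges}

end LoopHypergraph

section Multilinear

/-- The `t`-linear form with coefficients `a`, where the basis vectors of all the factors are
selected simultaneously: `(x_j)_j ↦ ∑_v a(v) ∏_j x_j (s_j(v))`. -/
noncomputable def formOfCoeff {I ι : Type*} [Fintype I] [Fintype ι] {B : ι → Type*}
    [∀ j, Fintype (B j)] (s : ∀ j, I → B j) (a : I → ℝ) :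
    MultilinearMap ℝ (fun j : ι => EuclideanSpace ℝ (B j)) ℝ :=
  ∑ v : I, a v • (MultilinearMap.mkPiAlgebra ℝ ι ℝ).compLinearMap
    (fun j => (EuclideanSpace.proj (s j v) : EuclideanSpace ℝ (B j) →L[ℝ] ℝ).toLinearMap)

variable {V : Type*} [Fintype V] {k : ℕ}

open Classical in
/-- The adjacency map of `H`: the `k`-linear form on `W = ℝ^V` with
`τ(e_{v_1}, …, e_{v_k}) = 1` if `{v_1, …, v_k}` is an edge and `0` otherwise. -/
noncomputable def adjacencyMap (H : LoopHypergraph V k) :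
    MultilinearMap ℝ (fun _ : Fin k => EuclideanSpace ℝ V) ℝ :=
  formOfCoeff (fun j (v : Fin k → V) => v j) (fun v => if symOfFn v ∈ H.edges then 1 else 0)

/-- The all-ones map: the `k`-linear form on `ℝ^V` with `J(e_{v_1}, …, e_{v_k}) = 1` always. -/
noncomputable def allOnesMap (V : Type*) [Fintype V] (k : ℕ) :
    MultilinearMap ℝ (fun _ : Fin k => EuclideanSpace ℝ V) ℝ :=
  formOfCoeff (fun j (v : Fin k → V) => v j) (fun _ => 1)

/-- For an ordered partition `c = (k_1, …, k_t)` of `k`, the `t`-linear form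
`σ_c : W^{⊗k_1} × ⋯ × W^{⊗k_t} → ℝ` attached to the `k`-linear form `σ` on `W = ℝ^V`.
Here `W^{⊗m}` is the Euclidean space with orthonormal basis indexed by `V^m`, the index
`(v_1, …, v_m)` standing for `e_{v_1} ⊗ ⋯ ⊗ e_{v_m}`; the value of `σ_c` at the basis vectors that
are indexed by the consecutive blocks of `(v_1, …, v_k)` is `σ(e_{v_1}, …, e_{v_k})`. -/
noncomputable def flatten (σ : MultilinearMap ℝ (fun _ : Fin k => EuclideanSpace ℝ V) ℝ)
    (c : Composition k) :
    MultilinearMap ℝ (fun i : Fin c.length => EuclideanSpace ℝ (Fin (c.blocksFun i) → V)) ℝ :=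
  formOfCoeff (fun i (v : Fin k → V) => fun r => v (c.embedding i r))
    (fun v => σ (fun j => EuclideanSpace.basisFun V ℝ (v j)))

/-- The spectral norm of a multilinear form: the supremum of `|φ(x_1, …, x_t)|` over unit
vectors `x_i`. -/
noncomputable def formSpectralNorm {ι : Type*} {E : ι → Type*} [∀ i, NormedAddCommGroup (E i)]
    [∀ i, NormedSpace ℝ (E i)] (φ : MultilinearMap ℝ E ℝ) : ℝ :=
  sSup {r : ℝ | ∃ x : ∀ i, E i, (∀ i, ‖x i‖ = 1) ∧ r = |φ x|}

/-- The largest eigenvalue of `H` with respect to the ordered partition `c`. -/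
noncomputable def eig1 (H : LoopHypergraph V k) (c : Composition k) : ℝ :=
  formSpectralNorm (flatten (adjacencyMap H) c)

/-- The second largest eigenvalue of `H` with respect to the ordered partition `c`. -/
noncomputable def eig2 (H : LoopHypergraph V k) (c : Composition k) : ℝ :=
  formSpectralNorm (flatten (adjacencyMap H) c -
    ((k.factorial * H.edges.card : ℝ) / (Fintype.card V : ℝ) ^ k) • flatten (allOnesMap V k) c)

end Multilinear

section Cycle

/-- The code of length `t - 2` obtained from a code of length `t - 1` by removing the bit in
position `q` (positions are counted from `0`). -/
def removeBit {t : ℕ} (s : Fin (t - 1) → Bool) (q : ℕ) : Fin (t - 2) → Bool :=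
  fun i => s ⟨if (i : ℕ) < q then i else i + 1, by have := i.2; split <;> omega⟩

/-- The last bit of a code of length `t - 1` (only used for `t ≥ 2`). -/
def lastBit {t : ℕ} (s : Fin (t - 1) → Bool) : Bool :=
  if h : t - 2 < t - 1 then s ⟨t - 2, h⟩ else false

variable {k : ℕ}

/-- The vertices of the step of type `c = (k_1, …, k_t)`. The places `0, …, k - 1` of an edge are
cut into consecutive blocks of sizes `k_1, …, k_t`, and `c.index r` is the block (counted from `0`)
of the place `r`. The left summand is `A × [k_1]`, with codes of length `t - 1`, and the right
summand is the disjoint union of the `B_j × [k_j]` for `2 ≤ j ≤ t`, with codes of length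
`t - 2`. -/
abbrev StepVertex (c : Composition k) : Type :=
  ((Fin (c.length - 1) → Bool) × {r : Fin k // (c.index r : ℕ) = 0}) ⊕
    ((Fin (c.length - 2) → Bool) × {r : Fin k // (c.index r : ℕ) ≠ 0})

/-- The place `r` of the edge of the step that belongs to the code `s` of a vertex of `A`. In the
block `j + 1` with `j ≥ 1` (blocks counted from `1`) the code is `s` without its `j`-th bit. -/
def stepPlace (c : Composition k) (s : Fin (c.length - 1) → Bool) (r : Fin k) : StepVertex c :=
  if h : (c.index r : ℕ) = 0 then Sum.inl (s, ⟨r, h⟩)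
  else Sum.inr (removeBit s ((c.index r : ℕ) - 1), ⟨r, h⟩)

/-- The step of type `c`. -/
def stepHypergraph (c : Composition k) : LoopHypergraph (StepVertex c) k where
  edges := Finset.univ.image fun s : Fin (c.length - 1) → Bool => symOfFn (stepPlace c s)

/-- The vertices of the cycle that is glued from `N` steps of type `c`, cyclically, the second
attach tuple of each step (codes of vertices of `A` that end with `1`) being identified with the
first attach tuple of the next step (codes that end with `0`). Vertex `(i, u, r)` is, for `r` in the
first block, the vertex with code `u0` of `A` in step `i`, which is also the vertex with code `u1` of
`A` in the step before; for `r` in another block, it is the vertex with code `u` of that block's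
`B_j` in step `i`. -/
abbrev CycleVertex (c : Composition k) (N : ℕ) : Type :=
  Fin N × (Fin (c.length - 2) → Bool) × Fin k

/-- The map that sends the vertices of the `i`-th step to their classes in the cycle;
`finRotate N` is the cyclic successor on `Fin N`. -/
def glueStep (c : Composition k) (N : ℕ) (i : Fin N) : StepVertex c → CycleVertex c N
  | Sum.inl (s, r) =>
      (if lastBit s then finRotate N i else i, removeBit s (c.length - 2), (r : Fin k))
  | Sum.inr (u, r) => (i, u, (r : Fin k))

/-- The cycle of type `c` glued from `N` steps, which has length `2 * N`. -/
def cycleHypergraph (c : Composition k) (N : ℕ) : LoopHypergraph (CycleVertex c N) k where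
  edges := Finset.univ.biUnion fun i : Fin N =>
    (stepHypergraph c).edges.image (Sym.map (glueStep c N i))

end Cycle

/-! ### Averages over function spaces. -/

section Expectation

open Finset
open scoped BigOperators

/-! Let `T` be the indicator of the ordered edges, `μ` its mean, and group the `k` places by the
blocks of `π` into `t = m + 2` variables. Each variable ranges over all of `Ω = V^k`, only the
coordinates of its own block mattering; so all variables have one type.

Gluing steps is matrix multiplication. The matrix `K` (`stepKernel`) is positive semidefinite with
trace at most 1, `tr K^N` is the homomorphism density of the cycle of `N` steps, and the all-ones
vector has Rayleigh quotient at least `a = μ^(2^(t-1))`. Hence `a^N` is at most the cycle density;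
with the lower bound on the number of edges this forces `μ → p`. Now `tr K^N ≤ a^N + o(1)` leaves
room for one large eigenvalue only, so `tr K^2 ≤ a^2 + o(1)` (`trace_sq_le_of_trace_pow_le`).

But `tr K^2` is the box value of `T`, which is therefore nearly the least possible for the mean `μ`.
By `abs_expect_mul_prod_sub_le`, `T` then acts on products of `L²`-bounded functions of single
blocks almost like the constant `μ`. After rescaling, this bounds the flattened forms
(`abs_flatten_sub_le`), for every ordering because `T` is symmetric. Loops and non-injective maps
contribute lower-order terms. -/

theorem expect_arrow_fin_succ {α : Type*} [Fintype α] {n : ℕ} (f : (Fin (n + 1) → α) → ℝ) :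
    𝔼 z, f z = 𝔼 w : α, 𝔼 p : Fin n → α, f (Fin.snoc p w) := by
  rw [← Finset.expect_product' univ univ (fun (w : α) (p : Fin n → α) => f (Fin.snoc p w)),
    Finset.univ_product_univ]
  exact (Fintype.expect_equiv (Fin.snocEquiv fun _ => α) _ _ fun _ => rfl).symm

theorem prod_expect {ι W : Type*} [Fintype ι] [DecidableEq ι] [Fintype W] (f : ι → W → ℝ) :
    ∏ i, 𝔼 w, f i w = 𝔼 w : ι → W, ∏ i, f i (w i) := by
  simp only [Fintype.expect_eq_sum_div_card, Finset.prod_div_distrib, Finset.prod_univ_sum,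
    Fintype.piFinset_univ]
  simp

theorem expect_arrow_bool_succ {W : Type*} [Fintype W] {r : ℕ}
    (f : ((Fin (r + 1) → Bool) → W) → ℝ) :
    𝔼 w, f w =
      𝔼 w : Bool → (Fin r → Bool) → W, f fun s => w (s (Fin.last r)) (Fin.init s) := by
  refine Fintype.expect_equiv
    ((Equiv.arrowCongr (Fin.snocEquiv fun _ : Fin (r + 1) => Bool).symm (Equiv.refl W)).trans
      (Equiv.curry Bool (Fin r → Bool) W)) _ _ fun w => ?_
  congr 1
  funext s
  simp [Fin.snocEquiv, Fin.snoc_init_self]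

theorem expect_mul_sq_le {α : Type*} [Fintype α] (f g : α → ℝ) :
    (𝔼 a, f a * g a) ^ 2 ≤ (𝔼 a, f a ^ 2) * 𝔼 a, g a ^ 2 := by
  simp only [Fintype.expect_eq_sum_div_card, div_pow, div_mul_div_comm, ← sq]
  gcongr
  exact Finset.sum_mul_sq_le_sq_mul_sq _ _ _

theorem expect_sub_mean_sq {α : Type*} [Fintype α] [Nonempty α] (f : α → ℝ) :
    𝔼 a, (f a - 𝔼 b, f b) ^ 2 = 𝔼 a, f a ^ 2 - (𝔼 b, f b) ^ 2 := by
  have : ∀ a, (f a - 𝔼 b, f b) ^ 2 = f a ^ 2 - (2 * 𝔼 b, f b) * f a + (𝔼 b, f b) ^ 2 := by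
    intro a; ring
  simp only [this, Finset.expect_add_distrib, Finset.expect_sub_distrib, ← Finset.mul_expect,
    Fintype.expect_const]
  ring

end Expectation

/-! ### The box form, its Cauchy–Schwarz inequality and stability at the minimum. -/

section BoxForm

open Finset
open scoped BigOperators

variable {Ω : Type*} [Fintype Ω]

/-- The polarized box form of `r` variables: starting from the last variable, all the other
variables are doubled once for each variable. -/
noncomputable def boxForm : (r : ℕ) → ((Fin r → Bool) → (Fin r → Ω) → ℝ) → ℝ
  | 0, F => F ![] ![]
  | r + 1, F => 𝔼 w : (Fin r → Bool) → Ω,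
      ∏ b : Bool, boxForm r fun s p => F (Fin.snoc s b) (Fin.snoc p (w s))

theorem boxForm_const_mul {r : ℕ} (c : (Fin r → Bool) → ℝ)
    (F : (Fin r → Bool) → (Fin r → Ω) → ℝ) :
    boxForm r (fun s p => c s * F s p) = (∏ s, c s) * boxForm r F := by
  induction r with
  | zero => simp [boxForm, Matrix.empty_eq]
  | succ r ih =>
    simp only [boxForm, ih, Finset.prod_mul_distrib, ← Finset.mul_expect]
    congr 1
    rw [← (Fin.snocEquiv fun _ : Fin (r + 1) => Bool).prod_comp, Fintype.prod_prod_type]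
    rfl

/-- The box form is multilinear in its `2^r` slots, so averages in the slots come out with an
independent variable for each slot. -/
theorem boxForm_expect {W : Type*} [Fintype W] {r : ℕ}
    (F : (Fin r → Bool) → W → (Fin r → Ω) → ℝ) :
    boxForm r (fun s p => 𝔼 w, F s w p) =
      𝔼 w : (Fin r → Bool) → W, boxForm r fun s p => F s (w s) p := by
  induction r with
  | zero =>
    simp only [boxForm]
    refine (Fintype.expect_equiv (Equiv.funUnique (Fin 0 → Bool) W) _ _ fun w => ?_).symm
    simp only [Equiv.funUnique_apply, Matrix.empty_eq]
  | succ r ih =>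
    simp only [boxForm, ih, prod_expect]
    rw [Finset.expect_comm, expect_arrow_bool_succ]
    simp

/-- The box form of a single function. -/
noncomputable def boxValue (r : ℕ) (g : (Fin r → Ω) → ℝ) : ℝ := boxForm r fun _ => g

theorem boxValue_succ {r : ℕ} (g : (Fin (r + 1) → Ω) → ℝ) :
    boxValue (r + 1) g =
      𝔼 w : (Fin r → Bool) → Ω, (boxForm r fun s p => g (Fin.snoc p (w s))) ^ 2 := by
  simp [boxValue, boxForm, sq]

/-- The box form on the right is the one squared in `boxValue_succ`; a single Cauchy–Schwarz in `w`
therefore leads from `r` to `r + 1`. -/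
theorem boxValue_average {r : ℕ} (g : (Fin (r + 1) → Ω) → ℝ) (x : Ω → ℝ) :
    boxValue r (fun p => 𝔼 w, x w * g (Fin.snoc p w)) =
      𝔼 w : (Fin r → Bool) → Ω, (∏ s, x (w s)) * boxForm r fun s p => g (Fin.snoc p (w s)) := by
  rw [boxValue, boxForm_expect]
  exact Finset.expect_congr rfl fun w _ => boxForm_const_mul (fun s => x (w s)) _

theorem expect_prod_arrow {ι : Type*} [Fintype ι] [DecidableEq ι] (x : Ω → ℝ) :
    𝔼 w : ι → Ω, ∏ s, x (w s) = (𝔼 w, x w) ^ Fintype.card ι := by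
  rw [← prod_expect]; simp

/-- The Gowers–Cauchy–Schwarz inequality for the box form. -/
theorem abs_expect_mul_prod_pow_le {r : ℕ} (g : (Fin r → Ω) → ℝ) (x : Fin r → Ω → ℝ)
    (hx : ∀ j, 𝔼 w, x j w ^ 2 ≤ 1) :
    |𝔼 z, g z * ∏ j, x j (z j)| ^ 2 ^ r ≤ |boxValue r g| := by
  induction r with
  | zero => simp [boxValue, boxForm, Matrix.empty_eq]
  | succ r ih =>
    have h1 := ih (fun p => 𝔼 w, x (Fin.last r) w * g (Fin.snoc p w))
      (fun j => x j.castSucc) fun j => hx _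
    have h2 : 𝔼 z, g z * ∏ j, x j (z j) =
        𝔼 p : Fin r → Ω, (𝔼 w, x (Fin.last r) w * g (Fin.snoc p w)) *
          ∏ j, x j.castSucc (p j) := by
      rw [expect_arrow_fin_succ, Finset.expect_comm]
      refine Finset.expect_congr rfl fun p _ => ?_
      rw [Finset.expect_mul]
      refine Finset.expect_congr rfl fun w _ => ?_
      simp [Fin.prod_univ_castSucc]
      ring
    rw [h2, pow_succ, pow_mul]
    calc _ ≤ |boxValue r fun p => 𝔼 w, x (Fin.last r) w * g (Fin.snoc p w)| ^ 2 := by gcongr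
      _ ≤ boxValue (r + 1) g := by
        rw [sq_abs, boxValue_average, boxValue_succ]
        refine (expect_mul_sq_le _ _).trans (mul_le_of_le_one_left ?_ ?_)
        · exact Finset.expect_nonneg fun _ _ => sq_nonneg _
        · simp only [← Finset.prod_pow]
          rw [expect_prod_arrow (fun a => x (Fin.last r) a ^ 2)]
          exact pow_le_one₀ (Finset.expect_nonneg fun _ _ => sq_nonneg _) (hx _)
      _ ≤ _ := le_abs_self _

variable [Nonempty Ω]

theorem abs_mean_pow_le {r : ℕ} (g : (Fin r → Ω) → ℝ) :
    |𝔼 z, g z| ^ 2 ^ r ≤ |boxValue r g| := by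
  simpa using abs_expect_mul_prod_pow_le g (fun _ _ => 1) fun _ => by simp

/-- A function whose box value is almost the smallest possible one for its mean is almost constant
when it is tested against products of functions of one variable. -/
theorem abs_expect_mul_prod_sub_le {r : ℕ} (g : (Fin r → Ω) → ℝ) {θ : ℝ} (hθ : 0 ≤ θ)
    (hg : |boxValue r g| ≤ |𝔼 z, g z| ^ 2 ^ r + θ ^ 2 ^ r)
    (x : Fin r → Ω → ℝ) (hx : ∀ j, 𝔼 w, x j w ^ 2 ≤ 1) :
    |𝔼 z, g z * ∏ j, x j (z j) - (𝔼 z, g z) * ∏ j, 𝔼 w, x j w| ≤ r * θ := by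
  induction r with
  | zero => simp
  | succ r ih =>
    set m := 𝔼 z, g z with hm
    set y : Ω → ℝ := x (Fin.last r) with hy
    set c := 𝔼 w, y w with hc
    set G : ((Fin r → Bool) → Ω) → ℝ := fun w => boxForm r fun s p => g (Fin.snoc p (w s))
      with hG
    set gbar : (Fin r → Ω) → ℝ := fun p => 𝔼 w, g (Fin.snoc p w) with hgbar
    have hmean : 𝔼 p, gbar p = m := by
      rw [hm, expect_arrow_fin_succ, Finset.expect_comm]
    have hGbar : boxValue r gbar = 𝔼 w, G w := by
      simpa using boxValue_average g (fun _ => 1)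
    have hGsq : 𝔼 w, G w ^ 2 = boxValue (r + 1) g := (boxValue_succ g).symm
    have hGm : |m| ^ 2 ^ r ≤ |𝔼 w, G w| := by
      rw [← hGbar, ← hmean]; exact abs_mean_pow_le gbar
    have hQ : 𝔼 w, G w ^ 2 ≤ (|m| ^ 2 ^ r) ^ 2 + (θ ^ 2 ^ r) ^ 2 := by
      rw [hGsq, ← pow_mul, ← pow_mul, ← pow_succ]
      exact (le_abs_self _).trans hg
    have hmr : 0 ≤ |m| ^ 2 ^ r := by positivity
    have hθr : 0 ≤ θ ^ 2 ^ r := by positivity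
    -- The mean of `G` is at least `|m|^(2^r)` in absolute value, and its second moment barely
    -- exceeds the square of this: `G` is almost constant.
    have hvar : 𝔼 w, (G w - 𝔼 u, G u) ^ 2 ≤ (θ ^ 2 ^ r) ^ 2 := by
      rw [expect_sub_mean_sq, ← sq_abs (𝔼 u, G u)]
      nlinarith
    -- The induction hypothesis will need this for `gbar`; it follows from `A² + B² ≤ (A + B)²`.
    have hGup : |𝔼 w, G w| ≤ |m| ^ 2 ^ r + θ ^ 2 ^ r := by
      refine abs_le_of_sq_le_sq' ?_ (by positivity) |> abs_le.mpr
      have := expect_sub_mean_sq G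
      have h0 : 0 ≤ 𝔼 w, (G w - 𝔼 u, G u) ^ 2 := Finset.expect_nonneg fun _ _ => sq_nonneg _
      nlinarith
    have hcy : 𝔼 w, (y w - c) ^ 2 ≤ 1 := by
      rw [hc, expect_sub_mean_sq]
      have := hx (Fin.last r)
      nlinarith [sq_nonneg (𝔼 w, y w)]
    have hc1 : |c| ≤ 1 := by
      rw [← sq_le_one_iff_abs_le_one]
      have h0 : 0 ≤ 𝔼 w, (y w - c) ^ 2 := Finset.expect_nonneg fun _ _ => sq_nonneg _
      rw [hc, expect_sub_mean_sq] at h0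
      have := hx (Fin.last r)
      linarith
    -- Since `y - c` has mean zero, so has the product of its copies. Thus `G` may be replaced by
    -- its deviation from the mean, which `hvar` controls.
    have hperp : |𝔼 p : Fin r → Ω, (𝔼 w, (y w - c) * g (Fin.snoc p w)) *
        ∏ j, x j.castSucc (p j)| ≤ θ := by
      refine le_of_pow_le_pow_left₀ (n := 2 ^ r) (by positivity) hθ ?_
      refine (abs_expect_mul_prod_pow_le _ (fun j => x j.castSucc) fun j => hx _).trans ?_
      rw [boxValue_average g fun w => y w - c]
      have hz : 𝔼 w : (Fin r → Bool) → Ω, ∏ s, (y (w s) - c) = 0 := by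
        rw [expect_prod_arrow (fun a => y a - c), Finset.expect_sub_distrib,
          Fintype.expect_const, hc, sub_self, zero_pow]
        simp
      have hsub : 𝔼 w : (Fin r → Bool) → Ω, (∏ s, (y (w s) - c)) * G w =
          𝔼 w : (Fin r → Bool) → Ω, (∏ s, (y (w s) - c)) * (G w - 𝔼 u, G u) := by
        simp only [mul_sub, Finset.expect_sub_distrib, ← Finset.expect_mul, hz]
        simp
      change |𝔼 w : (Fin r → Bool) → Ω, (∏ s, (y (w s) - c)) * G w| ≤ _
      rw [hsub]
      refine abs_le_of_sq_le_sq' ?_ hθr |> abs_le.mpr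
      refine (expect_mul_sq_le _ _).trans ?_
      refine (mul_le_of_le_one_left (Finset.expect_nonneg fun _ _ => sq_nonneg _) ?_).trans hvar
      simp only [← Finset.prod_pow]
      rw [expect_prod_arrow (fun a => (y a - c) ^ 2)]
      exact pow_le_one₀ (Finset.expect_nonneg fun _ _ => sq_nonneg _) hcy
    have hih := ih gbar (by rw [hGbar, hmean]; exact hGup) (fun j => x j.castSucc) fun j => hx _
    rw [hmean] at hih
    -- Write `y = (y - c) + c`: the first part costs `θ`, the second at most `r * θ` by induction.
    have hsplit : 𝔼 z, g z * ∏ j, x j (z j) - m * ∏ j, 𝔼 w, x j w =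
        (𝔼 p : Fin r → Ω, (𝔼 w, (y w - c) * g (Fin.snoc p w)) * ∏ j, x j.castSucc (p j)) +
        c * (𝔼 p : Fin r → Ω, gbar p * ∏ j, x j.castSucc (p j) -
          m * ∏ j : Fin r, 𝔼 w, x j.castSucc w) := by
      rw [Fin.prod_univ_castSucc, ← hy, ← hc, mul_sub c, Finset.mul_expect _ _ c, ← add_sub_assoc,
        ← Finset.expect_add_distrib, expect_arrow_fin_succ, Finset.expect_comm]
      congr 1
      · refine Finset.expect_congr rfl fun p _ => ?_
        rw [← mul_assoc, ← add_mul, hgbar, Finset.mul_expect, ← Finset.expect_add_distrib,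
          Finset.expect_mul]
        refine Finset.expect_congr rfl fun w _ => ?_
        simp [Fin.prod_univ_castSucc]
        ring
      · ring
    rw [hsplit]
    refine (abs_add_le _ _).trans ?_
    rw [abs_mul]
    have := mul_le_mul hc1 hih (abs_nonneg _) zero_le_one
    push_cast
    linarith

end BoxForm

/-! ### The box form as one average. -/

section ExplicitForm

open Finset
open scoped BigOperators

/-- Coordinates outside the range of `e` integrate out. This permits dummy variables: whole
`k`-tuples in place of blocks, and redundant codes. -/
theorem expect_comp_injective {A B V : Type*} [Fintype A] [Fintype B] [DecidableEq A]
    [DecidableEq B] [Fintype V] [Nonempty V] {e : A → B} (he : Function.Injective e)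
    (Φ : (A → V) → ℝ) : 𝔼 z : B → V, Φ (z ∘ e) = 𝔼 w, Φ w := by
  classical
  let E := (Equiv.piEquivPiSubtypeProd (fun b => b ∈ Set.range e) fun _ => V).trans
    (Equiv.prodCongr (Equiv.arrowCongr (Equiv.ofInjective e he).symm (Equiv.refl V))
      (Equiv.refl _))
  rw [Fintype.expect_equiv E (fun z => Φ (z ∘ e)) (fun q => Φ q.1) (fun z => rfl),
    ← Finset.univ_product_univ, Finset.expect_product]
  simp

/-- The copy of variable `j` used at `s` does not depend on bit `j`. Resetting that bit instead of
deleting it keeps the type of codes fixed; copies whose bit is `true` are dummies. -/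
theorem boxForm_eq_expect {Ω : Type*} [Fintype Ω] [Nonempty Ω] {r : ℕ}
    (F : (Fin r → Bool) → (Fin r → Ω) → ℝ) :
    boxForm r F = 𝔼 z : Fin r → (Fin r → Bool) → Ω,
      ∏ s, F s fun j => z j (Function.update s j false) := by
  induction r with
  | zero => simp [boxForm, Matrix.empty_eq]
  | succ r ih =>
    have hinj : Function.Injective
        fun s : Fin r → Bool => (Fin.snoc s false : Fin (r + 1) → Bool) :=
      fun s t h => (Fin.snoc_injective2 h).1
    rw [expect_arrow_fin_succ, boxForm]
    simp only [ih, prod_expect]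
    rw [← expect_comp_injective hinj]
    refine Finset.expect_congr rfl fun w _ => ?_
    refine (Fintype.expect_equiv
      { toFun := fun (z : Fin r → (Fin (r + 1) → Bool) → Ω) b j s => z j (Fin.snoc s b)
        invFun := fun z j s => z (s (Fin.last r)) j (Fin.init s)
        left_inv := fun z => by simp
        right_inv := fun z => by simp } _ _ fun z => ?_).symm
    rw [← (Fin.snocEquiv fun _ : Fin (r + 1) => Bool).prod_comp, Fintype.prod_prod_type]
    refine Finset.prod_congr rfl fun b _ => Finset.prod_congr rfl fun s _ => ?_
    change F (Fin.snoc s b) _ = F (Fin.snoc s b) _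
    congr 1
    funext j
    refine Fin.lastCases ?_ (fun j => ?_) j
    · simp [Fin.snocEquiv, Fin.update_snoc_last]
    · simp [Fin.snocEquiv, Fin.snoc_update]

end ExplicitForm

/-! ### Traces of powers as sums over closed walks. -/

section CyclicTrace

variable {Y R : Type*} [Fintype Y] [DecidableEq Y] [CommRing R]

theorem matrix_pow_succ_apply_eq_sum (M : Matrix Y Y R) (n : ℕ) (a b : Y) :
    (M ^ (n + 1)) a b = ∑ y : Fin n → Y, ∏ i : Fin (n + 1),
      M ((Fin.cons a y : Fin (n + 1) → Y) i) ((Fin.snoc y b : Fin (n + 1) → Y) i) := by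
  induction n generalizing a with
  | zero => simp [Fin.snoc]
  | succ n ih =>
    rw [pow_succ', Matrix.mul_apply, ← (Fin.consEquiv fun _ : Fin (n + 1) => Y).sum_comp,
      Fintype.sum_prod_type]
    refine Finset.sum_congr rfl fun c _ => ?_
    rw [ih, Finset.mul_sum]
    refine Finset.sum_congr rfl fun y _ => ?_
    rw [Fin.prod_univ_succ (n := n + 1)]
    simp only [Fin.consEquiv, Equiv.coe_fn_mk, ← Fin.cons_snoc_eq_snoc_cons, Fin.cons_zero,
      Fin.cons_succ]

theorem matrix_trace_pow_eq_sum (M : Matrix Y Y R) {N : ℕ} (hN : N ≠ 0) :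
    (M ^ N).trace = ∑ y : Fin N → Y, ∏ i, M (y i) (y (finRotate N i)) := by
  obtain ⟨n, rfl⟩ := Nat.exists_eq_succ_of_ne_zero hN
  rw [← (Fin.consEquiv fun _ : Fin (n + 1) => Y).sum_comp, Fintype.sum_prod_type]
  simp only [Matrix.trace, Matrix.diag, Nat.succ_eq_add_one, matrix_pow_succ_apply_eq_sum,
    Fin.snoc_eq_cons_rotate]
  rfl

end CyclicTrace

/-! ### Eigenvalues and traces of powers. -/

section Spectral

open Matrix

variable {Y : Type*} [Fintype Y] [DecidableEq Y] {K : Matrix Y Y ℝ}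

theorem trace_pow_eq_sum_eigenvalues_pow (hK : K.IsHermitian) (N : ℕ) :
    (K ^ N).trace = ∑ i, hK.eigenvalues i ^ N := by
  conv_lhs => rw [hK.spectral_theorem, ← map_pow, Matrix.diagonal_pow]
  rw [Unitary.conjStarAlgAut_apply, Matrix.trace_mul_cycle]
  simp [Matrix.trace]

/-- In an eigenbasis the Rayleigh quotient of `v` is a weighted mean of the eigenvalues. -/
theorem exists_le_eigenvalue (hK : K.IsHermitian) {a : ℝ} {v : Y → ℝ} (hv : v ≠ 0)
    (h : a * (v ⬝ᵥ v) ≤ v ⬝ᵥ (K *ᵥ v)) : ∃ i, a ≤ hK.eigenvalues i := by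
  by_contra! hlt
  set U : Matrix Y Y ℝ := hK.eigenvectorUnitary.1 with hU
  set u : Y → ℝ := star U *ᵥ v with hu
  have hvu : v ᵥ* U = u := by
    rw [hu, Matrix.star_eq_conjTranspose, Matrix.conjTranspose_eq_transpose_of_trivial,
      Matrix.mulVec_transpose]
  have hUU : U * star U = 1 := Unitary.coe_mul_star_self _
  have h1 : v ⬝ᵥ v = ∑ i, u i ^ 2 := by
    calc v ⬝ᵥ v = v ⬝ᵥ ((U * star U) *ᵥ v) := by rw [hUU, Matrix.one_mulVec]
      _ = u ⬝ᵥ u := by rw [← Matrix.mulVec_mulVec, Matrix.dotProduct_mulVec, hvu]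
      _ = _ := by simp [dotProduct, sq]
  have h2 : v ⬝ᵥ (K *ᵥ v) = ∑ i, hK.eigenvalues i * u i ^ 2 := by
    conv_lhs => rw [hK.spectral_theorem, Unitary.conjStarAlgAut_apply]
    rw [← hU, ← Matrix.mulVec_mulVec, ← Matrix.mulVec_mulVec, Matrix.dotProduct_mulVec, hvu]
    simp only [dotProduct, Matrix.mulVec_diagonal, Function.comp]
    exact Finset.sum_congr rfl fun i _ => by simp [← hu]; ring
  have hu0 : ∃ i, u i ≠ 0 := by
    by_contra! hu0
    refine hv ?_
    rw [← Matrix.one_mulVec v, ← hUU, ← Matrix.mulVec_mulVec, ← hu,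
      show u = 0 from funext hu0, Matrix.mulVec_zero]
  obtain ⟨i, hi⟩ := hu0
  rw [h1, h2, Finset.mul_sum] at h
  refine absurd h (not_le.mpr (Finset.sum_lt_sum (fun j _ => ?_) ⟨i, Finset.mem_univ i, ?_⟩))
  · exact mul_le_mul_of_nonneg_right (hlt j).le (sq_nonneg _)
  · exact mul_lt_mul_of_pos_right (hlt i) (by positivity)

/-- One eigenvalue is at least `a` and uses up `a^N` of the trace. So it is at most `a + θ`, every
other one is at most `θ`, and the squares of the others sum to at most `θ * tr K ≤ θ`. -/
theorem trace_sq_le_of_trace_pow_le (hK : K.PosSemidef) (htr : K.trace ≤ 1) {a θ : ℝ}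
    (ha : 0 ≤ a) (hθ : 0 ≤ θ) {v : Y → ℝ} (hv : v ≠ 0)
    (h : a * (v ⬝ᵥ v) ≤ v ⬝ᵥ (K *ᵥ v)) {N : ℕ} (hN : N ≠ 0)
    (hp : (K ^ N).trace ≤ a ^ N + θ ^ N) : (K ^ 2).trace ≤ (a + θ) ^ 2 + θ := by
  obtain ⟨i, hi⟩ := exists_le_eigenvalue hK.1 hv h
  have h0 := hK.eigenvalues_nonneg
  set μ := hK.1.eigenvalues
  have htr1 : ∑ j, μ j ≤ 1 := by
    have := trace_pow_eq_sum_eigenvalues_pow hK.1 1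
    simp only [pow_one] at this
    exact this ▸ htr
  rw [trace_pow_eq_sum_eigenvalues_pow hK.1] at hp ⊢
  change ∑ j, μ j ^ 2 ≤ _
  replace hp : ∑ j, μ j ^ N ≤ a ^ N + θ ^ N := hp
  rw [← Finset.add_sum_erase _ _ (Finset.mem_univ i)] at hp htr1 ⊢
  have hnn : 0 ≤ ∑ j ∈ Finset.univ.erase i, μ j ^ N :=
    Finset.sum_nonneg fun j _ => pow_nonneg (h0 j) _
  have hiN : a ^ N ≤ μ i ^ N := pow_le_pow_left₀ ha hi _
  have hμi : μ i ≤ a + θ := by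
    refine le_of_pow_le_pow_left₀ hN (by positivity) ?_
    have := pow_add_pow_le ha hθ hN
    linarith
  have hμj : ∀ j ∈ Finset.univ.erase i, μ j ≤ θ := fun j hj => by
    refine le_of_pow_le_pow_left₀ hN hθ ?_
    have := Finset.single_le_sum (f := fun j => μ j ^ N) (fun j _ => pow_nonneg (h0 j) _) hj
    linarith
  have hrest : ∑ j ∈ Finset.univ.erase i, μ j ^ 2 ≤ θ * ∑ j ∈ Finset.univ.erase i, μ j := by
    rw [Finset.mul_sum]
    refine Finset.sum_le_sum fun j hj => ?_
    rw [sq]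
    exact mul_le_mul_of_nonneg_right (hμj j hj) (h0 j)
  have h3 : ∑ j ∈ Finset.univ.erase i, μ j ≤ 1 := by linarith [h0 i]
  have h4 : μ i ^ 2 ≤ (a + θ) ^ 2 := pow_le_pow_left₀ (h0 i) hμi 2
  nlinarith

theorem pow_le_trace_pow (hK : K.PosSemidef) {a : ℝ} (ha : 0 ≤ a) {v : Y → ℝ} (hv : v ≠ 0)
    (h : a * (v ⬝ᵥ v) ≤ v ⬝ᵥ (K *ᵥ v)) (N : ℕ) : a ^ N ≤ (K ^ N).trace := by
  obtain ⟨i, hi⟩ := exists_le_eigenvalue hK.1 hv h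
  rw [trace_pow_eq_sum_eigenvalues_pow hK.1]
  exact (pow_le_pow_left₀ ha hi N).trans
    (Finset.single_le_sum (f := fun j => hK.1.eigenvalues j ^ N)
      (fun j _ => pow_nonneg (hK.eigenvalues_nonneg j) _) (Finset.mem_univ i))

end Spectral

/-! ### The step as a positive semidefinite matrix. -/

section StepKernel

open Finset Matrix
open scoped BigOperators

variable {Ω : Type*} [Fintype Ω]

theorem abs_boxForm_le_one [Nonempty Ω] {r : ℕ} {F : (Fin r → Bool) → (Fin r → Ω) → ℝ}
    (hF : ∀ s p, |F s p| ≤ 1) : |boxForm r F| ≤ 1 := by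
  rw [boxForm_eq_expect]
  refine (Finset.abs_expect_le _ _).trans (Finset.expect_le univ_nonempty fun z _ => ?_)
  rw [Finset.abs_prod]
  exact Finset.prod_le_one (fun _ _ => abs_nonneg _) fun s _ => hF _ _

/-- The factor of the step kernel that keeps one copy of the last two variables. -/
noncomputable def halfKernel {m : ℕ} (g : (Fin (m + 2) → Ω) → ℝ) (y w : (Fin m → Bool) → Ω) : ℝ :=
  boxForm m fun s p => g (Fin.snoc (Fin.snoc p (w s) : Fin (m + 1) → Ω) (y s))

/-- The normalized average of a step with both attach tuples prescribed. -/
noncomputable def stepKernel {m : ℕ} (g : (Fin (m + 2) → Ω) → ℝ) :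
    Matrix ((Fin m → Bool) → Ω) ((Fin m → Bool) → Ω) ℝ :=
  .of fun y y' => (𝔼 w, halfKernel g y w * halfKernel g y' w) /
    Fintype.card ((Fin m → Bool) → Ω)

variable {m : ℕ} (g : (Fin (m + 2) → Ω) → ℝ)

/-- The shared tuple `w` makes the kernel a multiple of a Gram matrix. -/
theorem stepKernel_posSemidef : (stepKernel g).PosSemidef := by
  set n : ℝ := (Fintype.card ((Fin m → Bool) → Ω) : ℝ)
  have h : stepKernel g = (n * n)⁻¹ • (Matrix.of (halfKernel g) * (Matrix.of (halfKernel g))ᴴ) := by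
    ext y y'
    simp only [stepKernel, Matrix.of_apply, Matrix.smul_apply, Matrix.mul_apply,
      Matrix.conjTranspose_apply, star_trivial, smul_eq_mul, Fintype.expect_eq_sum_div_card]
    rw [div_div, inv_mul_eq_div]
  rw [h]
  exact (Matrix.posSemidef_self_mul_conjTranspose _).smul (by positivity)

theorem stepKernel_apply (y y' : (Fin m → Bool) → Ω) :
    stepKernel g y y' = boxForm (m + 1) (fun s p => g (Fin.snoc p
      ((if s (Fin.last m) then y' else y) (Fin.init s)))) /
        Fintype.card ((Fin m → Bool) → Ω) := by
  simp [stepKernel, boxForm, halfKernel, mul_comm]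

theorem trace_stepKernel_le_one [Nonempty Ω] (hg : ∀ z, |g z| ≤ 1) :
    (stepKernel g).trace ≤ 1 := by
  have : (stepKernel g).trace = 𝔼 y, 𝔼 w, halfKernel g y w ^ 2 := by
    simp [Matrix.trace, stepKernel, Fintype.expect_eq_sum_div_card (ι := (Fin m → Bool) → Ω),
      Finset.sum_div, sq]
  rw [this]
  refine Finset.expect_le univ_nonempty fun y _ => Finset.expect_le univ_nonempty fun w _ => ?_
  exact (sq_le_one_iff_abs_le_one _).mpr (abs_boxForm_le_one fun _ _ => hg _)

/-- The right side is the number of tuples times the box value of `g` averaged over its last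
variable, and that average has the same mean as `g`. -/
theorem mean_pow_le_stepKernel [Nonempty Ω] :
    |𝔼 z, g z| ^ 2 ^ (m + 1) * ((1 : ((Fin m → Bool) → Ω) → ℝ) ⬝ᵥ 1) ≤
      1 ⬝ᵥ (stepKernel g *ᵥ 1) := by
  set gbar : (Fin (m + 1) → Ω) → ℝ := fun p => 𝔼 w, g (Fin.snoc p w) with hgbar
  have hmean : 𝔼 p, gbar p = 𝔼 z, g z := by
    rw [expect_arrow_fin_succ g, Finset.expect_comm]
  have h1 : boxValue (m + 1) gbar = 𝔼 y, 𝔼 y', 𝔼 w, halfKernel g y w * halfKernel g y' w := by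
    rw [boxValue_succ]
    simp only [hgbar, boxForm_expect]
    have : ∀ w : (Fin m → Bool) → Ω, (𝔼 y, halfKernel g y w) ^ 2 =
        𝔼 y, 𝔼 y', halfKernel g y w * halfKernel g y' w := fun w => by
      rw [sq, Fintype.expect_mul_expect]
    change 𝔼 w, (𝔼 y, halfKernel g y w) ^ 2 = _
    simp only [this]
    rw [Finset.expect_comm]
    exact Finset.expect_congr rfl fun y _ => Finset.expect_comm _ _ _
  have h2 : (1 : ((Fin m → Bool) → Ω) → ℝ) ⬝ᵥ (stepKernel g *ᵥ 1) =
      boxValue (m + 1) gbar * Fintype.card ((Fin m → Bool) → Ω) := by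
    have hc : (Fintype.card ((Fin m → Bool) → Ω) : ℝ) ≠ 0 := by simp
    rw [h1, mul_comm, Fintype.card_mul_expect]
    simp only [dotProduct, Matrix.mulVec, stepKernel, Matrix.of_apply, Pi.one_apply, mul_one,
      one_mul]
    exact Finset.sum_congr rfl fun y _ => by
      rw [Fintype.expect_eq_sum_div_card, Finset.sum_div]
  have h3 : 0 ≤ boxValue (m + 1) gbar := by
    rw [boxValue_succ]; exact Finset.expect_nonneg fun _ _ => sq_nonneg _
  rw [h2]
  have h4 := abs_mean_pow_le gbar
  rw [hmean, abs_of_nonneg h3] at h4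
  refine (mul_le_mul_of_nonneg_right h4 ?_).trans_eq ?_
  · simp [dotProduct]
  · simp [dotProduct]

variable [DecidableEq Ω]

theorem trace_stepKernel_pow {N : ℕ} (hN : N ≠ 0) :
    (stepKernel g ^ N).trace = 𝔼 y : Fin N → (Fin m → Bool) → Ω,
      ∏ i, boxForm (m + 1) (fun s p => g (Fin.snoc p
        (y (if s (Fin.last m) then finRotate N i else i) (Fin.init s)))) := by
  simp only [matrix_trace_pow_eq_sum _ hN, stepKernel_apply, Finset.prod_div_distrib,
    Fintype.expect_eq_sum_div_card, Finset.sum_div]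
  simp only [Finset.prod_const, Finset.card_univ, Fintype.card_pi, Fintype.card_fin]
  refine Finset.sum_congr rfl fun y _ => ?_
  push_cast
  congr 1
  refine Finset.prod_congr rfl fun i _ => ?_
  congr 1
  funext s p
  split_ifs <;> rfl

/-- By symmetry of the kernel, closed walks of length 2 contribute squares of entries; these are the
squares in the outermost level of the box recursion. -/
theorem trace_stepKernel_sq : (stepKernel g ^ 2).trace = boxValue (m + 2) g := by
  rw [boxValue_succ, expect_arrow_bool_succ, trace_stepKernel_pow g two_ne_zero]
  refine Fintype.expect_equiv (Equiv.arrowCongr finTwoEquiv (Equiv.refl _)) _ _ fun y => ?_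
  -- The cardinality can be cancelled unless `Ω` is empty, and then there is no `y`.
  have hcard : (Fintype.card ((Fin m → Bool) → Ω) : ℝ) ≠ 0 ∨ IsEmpty Ω := by
    rcases isEmpty_or_nonempty Ω with h | h
    · exact Or.inr h
    · exact Or.inl (by simp)
  rcases hcard with hcard | hΩ
  · have hs := (stepKernel_posSemidef g).1.apply (y 1) (y 0)
    simp only [stepKernel_apply, star_trivial] at hs
    have hs' := (div_left_inj' hcard).mp hs
    have h0 : finRotate 2 0 = 1 := rfl
    have h1 : finRotate 2 1 = 0 := rfl
    rw [Fin.prod_univ_two, h0, h1, sq]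
    have key : ∀ u v : (Fin m → Bool) → Ω, ∀ w : Bool → (Fin m → Bool) → Ω, w false = u →
        w true = v → (fun (s : Fin (m + 1) → Bool) (p : Fin (m + 1) → Ω) =>
          g (Fin.snoc p (w (s (Fin.last m)) (Fin.init s)))) = fun s p => g (Fin.snoc p
            ((if s (Fin.last m) then v else u) (Fin.init s))) := by
      rintro u v w rfl rfl
      funext s p
      rcases h : s (Fin.last m) <;> simp
    have e1 := key (y 0) (y 1) (fun b => y (if b then 1 else 0)) rfl rfl
    have e2 := key (y 1) (y 0) (fun b => y (if b then 0 else 1)) rfl rfl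
    have e3 := key (y 0) (y 1) (Equiv.arrowCongr finTwoEquiv (Equiv.refl _) y) rfl rfl
    rw [e1, e2, e3, hs']
  · exact (hΩ.false (y 0 fun _ => false)).elim

theorem boxValue_le_of_trace_pow_le [Nonempty Ω] (hg : ∀ z, |g z| ≤ 1) {N : ℕ} (hN : N ≠ 0)
    {θ : ℝ} (hθ : 0 ≤ θ)
    (h : (stepKernel g ^ N).trace ≤ (|𝔼 z, g z| ^ 2 ^ (m + 1)) ^ N + θ ^ N) :
    boxValue (m + 2) g ≤ (|𝔼 z, g z| ^ 2 ^ (m + 1) + θ) ^ 2 + θ := by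
  rw [← trace_stepKernel_sq]
  exact trace_sq_le_of_trace_pow_le (stepKernel_posSemidef g) (trace_stepKernel_le_one g hg)
    (by positivity) hθ one_ne_zero (mean_pow_le_stepKernel g) hN h

theorem mean_pow_le_trace_stepKernel_pow [Nonempty Ω] (N : ℕ) :
    (|𝔼 z, g z| ^ 2 ^ (m + 1)) ^ N ≤ (stepKernel g ^ N).trace :=
  pow_le_trace_pow (stepKernel_posSemidef g) (by positivity) one_ne_zero
    (mean_pow_le_stepKernel g) N

end StepKernel

/-! ### The trace of a power as a cycle density. -/

section CyclePlace

open Finset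
open scoped BigOperators

variable {k m N : ℕ}

/-- The vertex at the place `q` of the edge with code `s` in the `i`-th step of the cycle, where the
place `q` lies in the block `blk q` and the last block is the one of the attach tuples. -/
def cyclePlace (blk : Fin k → Fin (m + 2)) (i : Fin N) (s : Fin (m + 1) → Bool) (q : Fin k) :
    Fin N × (Fin m → Bool) × Fin k :=
  if h : blk q = Fin.last (m + 1) then
    (if s (Fin.last m) then finRotate N i else i, Fin.init s, q)
  else (i, ((blk q).castPred h).removeNth s, q)

set_option synthInstance.maxSize 1000 in
theorem trace_stepKernel_pow_eq_cycle {V : Type*} [Fintype V] [Nonempty V] [DecidableEq V]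
    (blk : Fin k → Fin (m + 2)) (T : (Fin k → V) → ℝ) (hN : N ≠ 0) :
    (stepKernel (fun z : Fin (m + 2) → Fin k → V => T fun q => z (blk q) q) ^ N).trace =
      𝔼 f : Fin N × (Fin m → Bool) × Fin k → V,
        ∏ i, ∏ s, T fun q => f (cyclePlace blk i s q) := by
  -- Each cycle vertex selects one coordinate of the expanded trace: of an attach tuple, or of the
  -- copy of another block whose code has `false` inserted. All remaining coordinates are dummies.
  let e : Fin N × (Fin m → Bool) × Fin k → (Fin N × (Fin m → Bool) × Fin k) ⊕
      (Fin N × Fin (m + 1) × (Fin (m + 1) → Bool) × Fin k) := fun v =>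
    if h : blk v.2.2 = Fin.last (m + 1) then Sum.inl v
    else Sum.inr (v.1, (blk v.2.2).castPred h, ((blk v.2.2).castPred h).insertNth false v.2.1,
      v.2.2)
  have he : Function.Injective e := by
    rintro ⟨i, u, q⟩ ⟨i', u', q'⟩ h
    simp only [e] at h
    split_ifs at h with h1 h2
    · exact Sum.inl_injective h
    · simp only [Sum.inr.injEq, Prod.mk.injEq] at h
      obtain ⟨rfl, -, h3, rfl⟩ := h
      rw [Fin.insertNth_right_injective _ h3]
  rw [trace_stepKernel_pow _ hN]
  rw [← expect_comp_injective (V := V) he]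
  simp only [boxForm_eq_expect]
  simp only [prod_expect]
  rw [← Finset.expect_product' univ univ, Finset.univ_product_univ]
  refine (Fintype.expect_equiv
    { toFun := fun F : (Fin N × (Fin m → Bool) × Fin k) ⊕
        (Fin N × Fin (m + 1) × (Fin (m + 1) → Bool) × Fin k) → V => ((fun i u q => F (Sum.inl (i, u, q)),
        fun i j s q => F (Sum.inr (i, j, s, q))) :
        (Fin N → (Fin m → Bool) → Fin k → V) ×
        (Fin N → Fin (m + 1) → (Fin (m + 1) → Bool) → Fin k → V))
      invFun := fun F => Sum.elim (fun v => F.1 v.1 v.2.1 v.2.2)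
        fun v => F.2 v.1 v.2.1 v.2.2.1 v.2.2.2
      left_inv := fun F => by funext b; rcases b with b | b <;> rfl
      right_inv := fun F => rfl } _ _ fun F => ?_).symm
  refine Finset.prod_congr rfl fun i _ => Finset.prod_congr rfl fun s _ => ?_
  congr 1
  funext q
  by_cases h : blk q = Fin.last (m + 1)
  · simp [cyclePlace, e, h]
    rfl
  · obtain ⟨j, hj⟩ := Fin.exists_castSucc_eq.mpr h
    simp only [Function.comp, cyclePlace, h, dif_neg, e, not_false_eq_true,
      Fin.insertNth_removeNth]
    simp [← hj]
    rfl

theorem cyclePlace_injective {blk : Fin k → Fin (m + 2)} (hblk : Function.Surjective blk)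
    (hN : 2 ≤ N) : Function.Injective fun v : Fin N × (Fin (m + 1) → Bool) =>
      cyclePlace blk v.1 v.2 := by
  rintro ⟨i, s⟩ ⟨i', s'⟩ h
  obtain ⟨q, hq⟩ := hblk (Fin.castSucc 0)
  obtain ⟨q', hq'⟩ := hblk (Fin.last (m + 1))
  have h1 := congrFun h q
  have h2 := congrFun h q'
  simp only [cyclePlace, hq, hq', dif_pos, (Fin.castSucc_lt_last _).ne, dif_neg,
    not_false_eq_true, Prod.mk.injEq, and_true] at h1 h2
  obtain ⟨rfl, -⟩ := h1
  -- With a single step the two attach tuples would coincide and the last bit would be lost.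
  have hrot : finRotate N i ≠ i := by
    obtain ⟨n, rfl⟩ : ∃ n, N = n + 2 := ⟨N - 2, by omega⟩
    rw [finRotate_apply]
    simp
  have hlast : s (Fin.last m) = s' (Fin.last m) := by
    rcases h3 : s (Fin.last m) <;> rcases h4 : s' (Fin.last m) <;>
      simp only [h3, h4, if_true, Bool.false_eq_true, if_false] at h2 ⊢
    · exact absurd h2.1.symm hrot
    · exact absurd h2.1 hrot
  rw [Prod.mk.injEq, ← Fin.snoc_init_self s, ← Fin.snoc_init_self s', h2.2, hlast]
  exact ⟨rfl, rfl⟩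

end CyclePlace

/-! ### Multisets, reorderings and orderings of a partition. -/

section Relabel

theorem exists_equiv_of_map_univ_eq {α β γ : Type*} [Fintype α] [Fintype β] {f : α → γ}
    {g : β → γ} (h : Finset.univ.val.map f = Finset.univ.val.map g) :
    ∃ e : α ≃ β, ∀ a, g (e a) = f a := by
  classical
  have hc : ∀ c, Nonempty ({ a // f a = c } ≃ { b // g b = c }) := fun c => by
    have h1 := congrArg (Multiset.count c) h
    simp only [Multiset.count_map] at h1
    rw [← Fintype.card_eq, Fintype.card_subtype, Fintype.card_subtype]
    simp only [Finset.card, Finset.filter_val]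
    simpa only [eq_comm] using h1
  exact ⟨Equiv.ofFiberEquiv fun c => (hc c).some, fun a => Equiv.ofFiberEquiv_map _ a⟩

theorem symOfFn_comp_perm {V : Type*} {k : ℕ} (f : Fin k → V) (σ : Equiv.Perm (Fin k)) :
    symOfFn (f ∘ σ) = symOfFn f := by
  refine Subtype.ext ?_
  change Multiset.map (f ∘ σ) Finset.univ.val = Multiset.map f Finset.univ.val
  rw [← Multiset.map_map, Multiset.map_univ_val_equiv]

theorem map_symOfFn {U V : Type*} {k : ℕ} (g : U → V) (f : Fin k → U) :
    Sym.map g (symOfFn f) = symOfFn (g ∘ f) :=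
  Subtype.ext (Multiset.map_map g f Finset.univ.val)

theorem mem_symOfFn {V : Type*} {k : ℕ} {f : Fin k → V} {v : V} :
    v ∈ symOfFn f ↔ ∃ q, f q = v := by
  change v ∈ Multiset.map f Finset.univ.val ↔ _
  simp

/-- Two compositions with the same parts differ by a permutation of the places. -/
theorem exists_perm_of_ofComposition_eq {k : ℕ} {c d : Composition k}
    (h : Nat.Partition.ofComposition k c = Nat.Partition.ofComposition k d) :
    ∃ (β : Fin d.length ≃ Fin c.length) (ρ : Equiv.Perm (Fin k)),
      ∀ q, c.index (ρ q) = β (d.index q) := by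
  have hb : (c.blocks : Multiset ℕ) = d.blocks := congrArg Nat.Partition.parts h
  have hmap : ∀ a : Composition k,
      Finset.univ.val.map a.blocksFun = (a.blocks : Multiset ℕ) := fun a => by
    rw [← a.ofFn_blocksFun, Fin.univ_val_map]
  obtain ⟨β, hβ⟩ := exists_equiv_of_map_univ_eq
    (f := d.blocksFun) (g := c.blocksFun) (by rw [hmap, hmap, hb])
  refine ⟨β, d.blocksFinEquiv.symm.trans ((Equiv.sigmaCongr β fun i =>
    finCongr (hβ i).symm).trans c.blocksFinEquiv), fun q => ?_⟩
  obtain ⟨⟨i, r⟩, rfl⟩ := d.blocksFinEquiv.surjective q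
  simp only [Equiv.trans_apply, Equiv.symm_apply_apply]
  exact (c.index_embedding (β i) _).trans (congrArg β (d.index_embedding i r).symm)

end Relabel

/-! ### Lower-order errors from loops and non-injective maps. -/

section Counting

variable {V : Type*} [Fintype V] {k : ℕ}

open Classical in
/-- The indicator function of the ordered edges of `H`. -/
noncomputable def edgeIndicator (H : LoopHypergraph V k) (v : Fin k → V) : ℝ :=
  if symOfFn v ∈ H.edges then 1 else 0

theorem card_symOfFn_fiber_le [DecidableEq V] (e : Sym V k) :
    (Finset.univ.filter fun v : Fin k → V => symOfFn v = e).card ≤ k.factorial := by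
  rcases Finset.eq_empty_or_nonempty (Finset.univ.filter fun v : Fin k → V => symOfFn v = e)
    with h | ⟨v₀, hv₀⟩
  · simp [h]
  · calc _ ≤ (Finset.univ.image fun σ : Equiv.Perm (Fin k) => v₀ ∘ σ).card := by
          refine Finset.card_le_card fun v hv => ?_
          have h1 : symOfFn v = symOfFn v₀ := by
            rw [(Finset.mem_filter.mp hv).2, (Finset.mem_filter.mp hv₀).2]
          have h2 : Finset.univ.val.map v = Finset.univ.val.map v₀ := congrArg Subtype.val h1
          obtain ⟨σ, hσ⟩ := exists_equiv_of_map_univ_eq h2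
          exact Finset.mem_image.mpr ⟨σ, Finset.mem_univ _, funext hσ⟩
      _ ≤ _ := Finset.card_image_le
      _ = _ := by rw [Finset.card_univ, Fintype.card_perm, Fintype.card_fin]

theorem sum_edgeIndicator [DecidableEq V] (H : LoopHypergraph V k) : ∑ v, edgeIndicator H v =
    ∑ e ∈ H.edges, ((Finset.univ.filter fun v : Fin k → V => symOfFn v = e).card : ℝ) := by
  have h : ∀ v, edgeIndicator H v = if symOfFn v ∈ H.edges then (1 : ℝ) else 0 := fun v => by
    unfold edgeIndicator
    congr
  rw [Finset.sum_congr rfl fun v _ => h v, Finset.sum_boole, ← Nat.cast_sum, Nat.cast_inj, ← Finset.card_biUnion]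
  · congr 1
    ext v
    simp
  · intro e _ e' _ hne
    rw [Function.onFun, Finset.disjoint_left]
    intro v hv hv'
    exact hne ((Finset.mem_filter.mp hv).2.symm.trans (Finset.mem_filter.mp hv').2)

/-- A multiset with repetitions has fewer than `k!` orderings. The total deficit over all multisets
is `k! * (n + k - 1).choose k - n ^ k`, and the first term is the rising factorial. -/
theorem abs_factorial_mul_card_sub_sum_edgeIndicator_le (H : LoopHypergraph V k) :
    |(k.factorial * H.edges.card : ℝ) - ∑ v, edgeIndicator H v| ≤
      (Fintype.card V).ascFactorial k - (Fintype.card V : ℝ) ^ k := by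
  classical
  set fib : Sym V k → ℝ := fun e =>
    ((Finset.univ.filter fun v : Fin k → V => symOfFn v = e).card : ℝ) with hfib
  have h0 : ∀ e, 0 ≤ (k.factorial : ℝ) - fib e := fun e =>
    sub_nonneg.mpr (Nat.cast_le.mpr (card_symOfFn_fiber_le e))
  have h1 : (k.factorial * H.edges.card : ℝ) - ∑ v, edgeIndicator H v =
      ∑ e ∈ H.edges, ((k.factorial : ℝ) - fib e) := by
    rw [sum_edgeIndicator, Finset.sum_sub_distrib, Finset.sum_const, nsmul_eq_mul, mul_comm]
  have h2 : ∑ e, fib e = (Fintype.card V : ℝ) ^ k := by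
    have := sum_edgeIndicator (⟨Finset.univ⟩ : LoopHypergraph V k)
    rw [← this]
    simp [edgeIndicator]
  rw [h1, abs_of_nonneg (Finset.sum_nonneg fun e _ => h0 e)]
  refine (Finset.sum_le_univ_sum_of_nonneg h0).trans_eq ?_
  rw [Finset.sum_sub_distrib, h2, Finset.sum_const, Finset.card_univ, Sym.card_sym_eq_choose,
    nsmul_eq_mul, Nat.ascFactorial_eq_factorial_mul_choose', mul_comm]
  push_cast
  rfl

theorem card_le_labeledCopies_add {U : Type*} [Fintype U] [DecidableEq U]
    (F : LoopHypergraph U k) (H : LoopHypergraph V k)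
    (S : Finset (U → V)) (hS : ∀ f ∈ S, ∀ e ∈ F.edges, Sym.map f e ∈ H.edges) :
    (S.card : ℝ) ≤ F.labeledCopies H + ((Fintype.card V : ℝ) ^ Fintype.card U -
      (Fintype.card V).descFactorial (Fintype.card U)) := by
  classical
  have h1 : (S.filter Function.Injective).card ≤ F.labeledCopies H := by
    rw [LoopHypergraph.labeledCopies, ← Fintype.card_coe, ← Nat.card_eq_fintype_card]
    refine Nat.card_le_card_of_injective
      (fun f : {f // f ∈ S.filter Function.Injective} => (⟨⟨f.1, (Finset.mem_filter.mp f.2).2⟩,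
        hS f.1 (Finset.mem_filter.mp f.2).1⟩ :
          {f : U ↪ V // ∀ e ∈ F.edges, Sym.map f e ∈ H.edges})) fun f g h => ?_
    exact Subtype.ext (congrArg (fun x => (x.1 : U → V)) h)
  have h2 : (S.filter fun f => ¬ Function.Injective f).card +
      (Fintype.card V).descFactorial (Fintype.card U) ≤
        Fintype.card V ^ Fintype.card U := by
    rw [← Fintype.card_embedding_eq, ← Fintype.card_fun,
      ← Fintype.card_congr (Equiv.subtypeInjectiveEquivEmbedding U V), Fintype.card_subtype,
      ← Finset.card_univ (α := U → V), ← Finset.card_filter_add_card_filter_not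
        (s := (Finset.univ : Finset (U → V))) Function.Injective, add_comm]
    gcongr
    exact Finset.subset_univ S
  have h3 := Finset.card_filter_add_card_filter_not (s := S) Function.Injective
  have h1' : ((S.filter Function.Injective).card : ℝ) ≤ F.labeledCopies H := by exact_mod_cast h1
  have h2' : ((S.filter fun f => ¬ Function.Injective f).card : ℝ) +
      (Fintype.card V).descFactorial (Fintype.card U) ≤
        (Fintype.card V : ℝ) ^ Fintype.card U := by exact_mod_cast h2
  rw [← h3]
  push_cast
  linarith

theorem tendsto_ascFactorial_div_pow (k : ℕ) :
    Tendsto (fun n : ℕ => (n.ascFactorial k : ℝ) / (n : ℝ) ^ k) atTop (nhds 1) := by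
  induction k with
  | zero => simp
  | succ k ih =>
    have h : Tendsto (fun n : ℕ => ((n : ℝ) + k) / n) atTop (nhds 1) := by
      have h1 : Tendsto (fun n : ℕ => 1 + (k : ℝ) / n) atTop (nhds (1 + 0)) :=
        tendsto_const_nhds.add (tendsto_const_div_atTop_nhds_zero_nat _)
      rw [add_zero] at h1
      refine h1.congr' ?_
      filter_upwards [eventually_ne_atTop 0] with n hn
      field_simp
    have := h.mul ih
    rw [one_mul] at this
    refine this.congr fun n => ?_
    rw [Nat.ascFactorial_succ, pow_succ, div_mul_div_comm]
    push_cast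
    ring

theorem tendsto_descFactorial_div_pow (k : ℕ) :
    Tendsto (fun n : ℕ => (n.descFactorial k : ℝ) / (n : ℝ) ^ k) atTop (nhds 1) := by
  refine (isEquivalent_iff_tendsto_one ?_).mp (isEquivalent_descFactorial k)
  filter_upwards [eventually_ne_atTop 0] with n hn
  positivity

end Counting

/-! ### Comparison of the cycle with its model on `m + 2` blocks. -/

section CycleModel

variable {k : ℕ}

/-- The vertex of the cycle at the place `q` of the edge with code `s` of the `i`-th step, in terms
of the numbers `idx q` of the blocks. -/
def cyclePlaceAux (t : ℕ) (idx : Fin k → ℕ) {N : ℕ} (i : Fin N) (s : Fin (t - 1) → Bool)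
    (q : Fin k) : Fin N × (Fin (t - 2) → Bool) × Fin k :=
  (if idx q = 0 ∧ lastBit s then finRotate N i else i,
    removeBit s (if idx q = 0 then t - 2 else idx q - 1), q)

theorem glueStep_stepPlace (c : Composition k) {N : ℕ} (i : Fin N)
    (s : Fin (c.length - 1) → Bool) :
    glueStep c N i ∘ stepPlace c s = cyclePlaceAux c.length (fun q => c.index q) i s := by
  funext q
  simp only [Function.comp, stepPlace, cyclePlaceAux]
  split_ifs <;> simp_all [glueStep]

theorem mem_cycleHypergraph_edges (c : Composition k) (N : ℕ) (e) :
    e ∈ (cycleHypergraph c N).edges ↔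
      ∃ i s, symOfFn (cyclePlaceAux c.length (fun q => c.index q) i s) = e := by
  simp [cycleHypergraph, stepHypergraph, map_symOfFn, glueStep_stepPlace]

theorem removeBit_last {m : ℕ} (s : Fin (m + 1) → Bool) :
    removeBit (t := m + 2) s m = Fin.init s := by
  funext i
  have hi : (i : ℕ) < m := i.2
  simp only [removeBit, Fin.init, if_pos hi]
  rfl

theorem removeBit_eq_removeNth {m : ℕ} (s : Fin (m + 1) → Bool) (j : Fin (m + 1)) :
    removeBit (t := m + 2) s j = j.removeNth s := by
  funext i
  simp only [removeBit, Fin.removeNth]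
  congr 1
  refine Fin.ext ?_
  change (if (i : ℕ) < j then (i : ℕ) else i + 1) = ((j.succAbove (i : Fin m) : Fin (m + 1)) : ℕ)
  simp only [Fin.succAbove, Fin.lt_def, Fin.val_castSucc]
  split_ifs <;> simp

theorem lastBit_eq {m : ℕ} (s : Fin (m + 1) → Bool) :
    lastBit (t := m + 2) s = s (Fin.last m) := by
  rw [lastBit, dif_pos (by omega)]
  rfl

theorem cyclePlaceAux_eq {m N : ℕ} (idx : Fin k → ℕ) (hidx : ∀ q, idx q < m + 2) (i : Fin N)
    (s : Fin (m + 1) → Bool) :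
    cyclePlaceAux (m + 2) idx i s = cyclePlace (fun q => if _h : idx q = 0 then Fin.last (m + 1)
      else ⟨idx q - 1, by have := hidx q; omega⟩) i s := by
  funext q
  by_cases h : idx q = 0
  · simp only [cyclePlaceAux, cyclePlace, h, if_true, true_and, dite_true, lastBit_eq]
    rw [← removeBit_last]
    rfl
  · have hne : (⟨idx q - 1, by have := hidx q; omega⟩ : Fin (m + 2)) ≠ Fin.last (m + 1) := by
      have := hidx q
      simp only [ne_eq, Fin.ext_iff, Fin.val_last]
      omega
    simp only [cyclePlaceAux, cyclePlace, h, if_false, false_and, dite_false, hne]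
    rw [← removeBit_eq_removeNth]
    rfl

end CycleModel

section CycleModel

variable {k : ℕ}

/-- The number `t` is a free variable so that `m + 2` can be substituted for it, which is impossible
for `c.length`. -/
theorem exists_cyclePlace_eq_cyclePlaceAux {t : ℕ} (ht : 2 ≤ t) (idx : Fin k → Fin t) (N : ℕ) :
    ∃ (m : ℕ) (γ : Fin t ≃ Fin (m + 2))
      (φ : Fin N × (Fin m → Bool) × Fin k ≃ Fin N × (Fin (t - 2) → Bool) × Fin k)
      (ψ : (Fin (m + 1) → Bool) ≃ (Fin (t - 1) → Bool)),
      ∀ i s, cyclePlaceAux t (fun q => idx q) i (ψ s) = φ ∘ cyclePlace (γ ∘ idx) i s := by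
  obtain ⟨m, rfl⟩ : ∃ m, t = m + 2 := ⟨t - 2, by omega⟩
  -- The cycle is glued along block `0`, the model along the last block; the inverse rotation moves
  -- block `0` to the end.
  refine ⟨m, (finRotate (m + 2)).symm, Equiv.refl _, Equiv.refl _, fun i s => ?_⟩
  have h : (fun q => if _h : (idx q : ℕ) = 0 then Fin.last (m + 1)
      else ⟨(idx q : ℕ) - 1, by omega⟩) = (finRotate (m + 2)).symm ∘ idx := by
    funext q
    rw [Function.comp, eq_comm, Equiv.symm_apply_eq]
    split_ifs with h
    · rw [finRotate_last]
      exact Fin.ext h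
    · have h1 := (idx q).2
      rw [finRotate_of_lt (by omega)]
      exact Fin.ext (by omega : (idx q : ℕ) = (idx q : ℕ) - 1 + 1)
  exact (cyclePlaceAux_eq (fun q => idx q) (fun q => (idx q).2) i s).trans (by rw [h]; rfl)

theorem exists_cycle_model (c : Composition k) (hc : 2 ≤ c.length) (N : ℕ) :
    ∃ (m : ℕ) (γ : Fin c.length ≃ Fin (m + 2))
      (φ : Fin N × (Fin m → Bool) × Fin k ≃ CycleVertex c N),
      ∀ e, e ∈ (cycleHypergraph c N).edges ↔
        ∃ i s, symOfFn (φ ∘ cyclePlace (γ ∘ c.index) i s) = e := by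
  obtain ⟨m, γ, φ, ψ, h⟩ := exists_cyclePlace_eq_cyclePlaceAux hc c.index N
  refine ⟨m, γ, φ, fun e => ?_⟩
  rw [mem_cycleHypergraph_edges]
  simp only [← h]
  exact exists_congr fun i => ψ.surjective.exists

variable {m N : ℕ}

theorem cyclePlace_snd_snd (blk : Fin k → Fin (m + 2)) (i : Fin N) (s : Fin (m + 1) → Bool)
    (q : Fin k) : (cyclePlace blk i s q).2.2 = q := by
  unfold cyclePlace
  split_ifs <;> rfl

/-- A cycle vertex remembers its place, so the multiset of an edge determines the ordered edge,
hence the step and the code. -/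
theorem card_edges_ge_of_model {U : Type*} {blk : Fin k → Fin (m + 2)}
    (hblk : Function.Surjective blk) (hN : 2 ≤ N)
    (φ : Fin N × (Fin m → Bool) × Fin k ≃ U) {F : LoopHypergraph U k}
    (hF : ∀ e, e ∈ F.edges ↔ ∃ i s, symOfFn (φ ∘ cyclePlace blk i s) = e) :
    2 ^ (m + 1) * N ≤ F.edges.card := by
  have hinj : Function.Injective fun v : Fin N × (Fin (m + 1) → Bool) =>
      symOfFn (φ ∘ cyclePlace blk v.1 v.2) := fun v v' h => by
    replace h : symOfFn (φ ∘ cyclePlace blk v.1 v.2) = symOfFn (φ ∘ cyclePlace blk v'.1 v'.2) := h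
    refine cyclePlace_injective hblk hN (funext fun q => ?_)
    have hq : φ (cyclePlace blk v.1 v.2 q) ∈ symOfFn (φ ∘ cyclePlace blk v'.1 v'.2) := by
      rw [← h]
      exact mem_symOfFn.mpr ⟨q, rfl⟩
    obtain ⟨q', hq'⟩ := mem_symOfFn.mp hq
    have h1 := φ.injective hq'
    have h2 := congrArg (fun x => x.2.2) h1
    simp only [cyclePlace_snd_snd] at h2
    rw [h2] at h1
    exact h1.symm
  calc 2 ^ (m + 1) * N = (Finset.univ.map ⟨_, hinj⟩).card := by simp [mul_comm]
    _ ≤ _ := Finset.card_le_card fun e he => by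
      obtain ⟨v, -, rfl⟩ := Finset.mem_map.mp he
      exact (hF _).mpr ⟨v.1, v.2, rfl⟩

variable {V : Type*} [Fintype V]

open scoped BigOperators in
-- The product indicates that `f` is a homomorphism; the error term is the proportion of
-- non-injective maps.
theorem expect_cycle_le_labeledCopies [Nonempty V] {U : Type*} [Fintype U] [DecidableEq U]
    (blk : Fin k → Fin (m + 2)) (φ : Fin N × (Fin m → Bool) × Fin k ≃ U) {F : LoopHypergraph U k}
    (hF : ∀ e, e ∈ F.edges ↔ ∃ i s, symOfFn (φ ∘ cyclePlace blk i s) = e)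
    (H : LoopHypergraph V k) :
    𝔼 f : Fin N × (Fin m → Bool) × Fin k → V,
        ∏ i, ∏ s, edgeIndicator H (fun q => f (cyclePlace blk i s q)) ≤
      F.labeledCopies H / (Fintype.card V : ℝ) ^ Fintype.card U +
        (1 - (Fintype.card V).descFactorial (Fintype.card U) /
          (Fintype.card V : ℝ) ^ Fintype.card U) := by
  classical
  have h1 : 𝔼 f : Fin N × (Fin m → Bool) × Fin k → V,
      ∏ i, ∏ s, edgeIndicator H (fun q => f (cyclePlace blk i s q)) =
      𝔼 f : U → V, ∏ i, ∏ s, edgeIndicator H (fun q => f (φ (cyclePlace blk i s q))) :=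
    Fintype.expect_equiv (Equiv.arrowCongr φ (Equiv.refl V)) _ _ fun f => by simp
  have h2 : ∀ f : U → V, ∏ i, ∏ s, edgeIndicator H (fun q => f (φ (cyclePlace blk i s q))) =
      if ∀ e ∈ F.edges, Sym.map f e ∈ H.edges then 1 else 0 := fun f => by
    have h3 : (∀ e ∈ F.edges, Sym.map f e ∈ H.edges) ↔
        ∀ i s, symOfFn (fun q => f (φ (cyclePlace blk i s q))) ∈ H.edges := by
      constructor
      · intro h i s
        have := h _ ((hF _).mpr ⟨i, s, rfl⟩)
        rwa [map_symOfFn] at this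
      · intro h e he
        obtain ⟨i, s, rfl⟩ := (hF e).mp he
        rw [map_symOfFn]
        exact h i s
    split_ifs with h
    · rw [h3] at h
      exact Finset.prod_eq_one fun i _ => Finset.prod_eq_one fun s _ => by
        simp [edgeIndicator, h i s]
    · rw [h3] at h
      push Not at h
      obtain ⟨i, s, his⟩ := h
      exact Finset.prod_eq_zero (Finset.mem_univ i)
        (Finset.prod_eq_zero (Finset.mem_univ s) (by simp [edgeIndicator, his]))
  rw [h1, Finset.expect_congr rfl fun f _ => h2 f, Fintype.expect_eq_sum_div_card,
    Finset.sum_boole, Fintype.card_fun]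
  have h4 := card_le_labeledCopies_add F H
    (Finset.univ.filter fun f => ∀ e ∈ F.edges, Sym.map f e ∈ H.edges)
    fun f hf => (Finset.mem_filter.mp hf).2
  have h5 : (0 : ℝ) < (Fintype.card V : ℝ) ^ Fintype.card U := by positivity
  rw [← div_self h5.ne', ← sub_div, ← add_div]
  push_cast
  gcongr

end CycleModel

/-! ### From averages to flattened forms. -/

section Flatten

open scoped BigOperators

variable {V : Type*} [Fintype V] {k : ℕ}

theorem formOfCoeff_apply {I ι : Type*} [Fintype I] [Fintype ι] {B : ι → Type*}
    [∀ j, Fintype (B j)] (s : ∀ j, I → B j) (a : I → ℝ) (x : ∀ j, EuclideanSpace ℝ (B j)) :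
    formOfCoeff s a x = ∑ v, a v * ∏ j, x j (s j v) := by
  simp [formOfCoeff]

theorem formOfCoeff_basisFun (a : (Fin k → V) → ℝ) (w : Fin k → V) :
    formOfCoeff (fun j (v : Fin k → V) => v j) a
      (fun j => EuclideanSpace.basisFun V ℝ (w j)) = a w := by
  classical
  rw [formOfCoeff_apply, Finset.sum_eq_single w]
  · simp
  · intro v _ hv
    obtain ⟨j, hj⟩ := Function.ne_iff.mp hv
    rw [Finset.prod_eq_zero (Finset.mem_univ j) (by simp [hj]), mul_zero]
  · simp

theorem flatten_adjacencyMap_apply (H : LoopHypergraph V k) (d : Composition k)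
    (x : ∀ i : Fin d.length, EuclideanSpace ℝ (Fin (d.blocksFun i) → V)) :
    flatten (adjacencyMap H) d x =
      ∑ v, edgeIndicator H v * ∏ i, x i fun r => v (d.embedding i r) := by
  rw [flatten, formOfCoeff_apply]
  simp only [adjacencyMap, formOfCoeff_basisFun]
  rfl

theorem flatten_allOnesMap_apply (d : Composition k)
    (x : ∀ i : Fin d.length, EuclideanSpace ℝ (Fin (d.blocksFun i) → V)) :
    flatten (allOnesMap V k) d x =
      ∑ v : Fin k → V, ∏ i, x i fun r => v (d.embedding i r) := by
  rw [flatten, formOfCoeff_apply]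
  simp only [allOnesMap, formOfCoeff_basisFun, one_mul]

variable [Nonempty V]

/-- Here the ordering of the eigenvalues is freed from that of the cycle: `ρ` is absorbed by the
symmetry of `T`, and the padding drops out along `q ↦ (blk q, q)`. -/
theorem expect_blocks_eq [DecidableEq V] {t : ℕ} (blk : Fin k → Fin t) (d : Composition k)
    (β : Fin d.length ≃ Fin t) (ρ : Equiv.Perm (Fin k)) (hρ : ∀ q, blk (ρ q) = β (d.index q))
    (T : (Fin k → V) → ℝ) (hT : ∀ v, T (v ∘ ρ) = T v)
    (x : ∀ i : Fin d.length, (Fin (d.blocksFun i) → V) → ℝ) :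
    𝔼 z : Fin t → Fin k → V, T (fun q => z (blk q) q) *
        ∏ j, x (β.symm j) (fun r => z j (ρ (d.embedding (β.symm j) r))) =
      𝔼 v, T v * ∏ i, x i fun r => v (d.embedding i r) := by
  have he : Function.Injective fun q => (blk q, q) := fun q q' h => congrArg Prod.snd h
  rw [← Fintype.expect_equiv (Equiv.arrowCongr ρ.symm (Equiv.refl V))
      (fun v => T v * ∏ i, x i fun r => v (ρ (d.embedding i r))) _ fun v => by
      rw [← hT v]; rfl,
    ← expect_comp_injective he]
  refine (Fintype.expect_equiv (Equiv.curry (Fin t) (Fin k) V) _ _ fun z => ?_).symm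
  congr 1
  refine Fintype.prod_equiv β _ _ fun i => ?_
  rw [Equiv.symm_apply_apply]
  congr 1
  funext r
  simp [hρ, Function.curry]

theorem expect_blocks_mean {t : ℕ} (blk : Fin k → Fin t) (T : (Fin k → V) → ℝ) :
    𝔼 z : Fin t → Fin k → V, T (fun q => z (blk q) q) = 𝔼 v, T v := by
  classical
  have he : Function.Injective fun q => (blk q, q) := fun q q' h => congrArg Prod.snd h
  rw [← expect_comp_injective he]
  exact (Fintype.expect_equiv (Equiv.curry (Fin t) (Fin k) V) _ _ fun z => rfl).symm

theorem sqrt_natCast_pow_sq (n : ℕ) (b : ℕ) : (√(n : ℝ) ^ b) ^ 2 = (n : ℝ) ^ b := by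
  rw [← pow_mul, mul_comm, pow_mul, Real.sq_sqrt n.cast_nonneg]

/-- A bound for the flattened adjacency form in terms of the box value of the edge indicator. -/
theorem abs_flatten_sub_le {t : ℕ} (blk : Fin k → Fin t) (d : Composition k)
    (β : Fin d.length ≃ Fin t) (ρ : Equiv.Perm (Fin k)) (hρ : ∀ q, blk (ρ q) = β (d.index q))
    (H : LoopHypergraph V k) {θ : ℝ} (hθ : 0 ≤ θ)
    (hbox : |boxValue t fun z : Fin t → Fin k → V => edgeIndicator H fun q => z (blk q) q| ≤
      |𝔼 v, edgeIndicator H v| ^ 2 ^ t + θ ^ 2 ^ t)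
    (x : ∀ i : Fin d.length, EuclideanSpace ℝ (Fin (d.blocksFun i) → V)) (hx : ∀ i, ‖x i‖ = 1) :
    |flatten (adjacencyMap H) d x - (𝔼 v, edgeIndicator H v) * flatten (allOnesMap V k) d x| ≤
      √(Fintype.card V) ^ k * (t * θ) ∧
    |flatten (allOnesMap V k) d x| ≤ √(Fintype.card V) ^ k := by
  classical
  set n := Fintype.card V with hn
  have hn0 : (0 : ℝ) < √n := Real.sqrt_pos.mpr (by rw [hn]; exact_mod_cast Fintype.card_pos)
  -- This factor turns a Euclidean unit vector on `n ^ d.blocksFun i` points into a function of mean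
  -- square 1; the factors multiply to `√n ^ k`.
  set y : ∀ i : Fin d.length, (Fin (d.blocksFun i) → V) → ℝ :=
    fun i w => √n ^ d.blocksFun i * x i w with hy
  set X : Fin t → (Fin k → V) → ℝ := fun j z =>
    y (β.symm j) (fun r => z (ρ (d.embedding (β.symm j) r))) with hX
  have hX2 : ∀ j, 𝔼 z, X j z ^ 2 = 1 := fun j => by
    have hinj : Function.Injective fun r => ρ (d.embedding (β.symm j) r) :=
      ρ.injective.comp (d.embedding _).injective
    have h1 := expect_comp_injective hinj (fun w : _ → V => y (β.symm j) w ^ 2)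
    refine h1.trans ?_
    rw [Fintype.expect_eq_sum_div_card]
    simp only [hy, mul_pow, sqrt_natCast_pow_sq]
    rw [← Finset.mul_sum, Fintype.card_fun, Fintype.card_fin, ← hn]
    have h2 := hx (β.symm j)
    rw [EuclideanSpace.norm_eq, Real.sqrt_eq_one] at h2
    simp only [Real.norm_eq_abs, sq_abs] at h2
    rw [h2, mul_one, Nat.cast_pow, div_self]
    rw [← sqrt_natCast_pow_sq]
    positivity
  have hX1 : ∀ j, |𝔼 z, X j z| ≤ 1 := fun j => by
    have h1 := expect_sub_mean_sq (X j)
    have h0 : 0 ≤ 𝔼 z, (X j z - 𝔼 w, X j w) ^ 2 := Finset.expect_nonneg fun _ _ => sq_nonneg _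
    rw [hX2] at h1
    rw [← sq_le_one_iff_abs_le_one]
    linarith
  have hy_prod : ∀ v : Fin k → V, (∏ i, y i fun r => v (d.embedding i r)) =
      √n ^ k * ∏ i, x i fun r => v (d.embedding i r) := fun v => by
    rw [hy, Finset.prod_mul_distrib, Finset.prod_pow_eq_pow_sum, d.sum_blocksFun]
  have hcard : (Fintype.card (Fin k → V) : ℝ) = √n ^ k * √n ^ k := by
    rw [← sq, sqrt_natCast_pow_sq, Fintype.card_fun, Fintype.card_fin]
    push_cast
    rfl
  have hscale : ∀ T : (Fin k → V) → ℝ, 𝔼 v, T v * ∏ i, y i (fun r => v (d.embedding i r)) =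
      (∑ v, T v * ∏ i, x i fun r => v (d.embedding i r)) / √n ^ k := fun T => by
    rw [Fintype.expect_eq_sum_div_card, hcard, div_mul_eq_div_div]
    congr 1
    simp only [hy_prod, mul_left_comm _ (√n ^ k)]
    rw [← Finset.mul_sum, mul_div_cancel_left₀ _ (by positivity)]
  have hA := expect_blocks_eq blk d β ρ hρ (edgeIndicator H)
    (fun v => by simp only [edgeIndicator, symOfFn_comp_perm]) y
  have hJ := expect_blocks_eq blk d β ρ hρ (fun _ => (1 : ℝ)) (fun _ => rfl) y
  rw [hscale] at hA hJ
  simp only [one_mul] at hJ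
  rw [← flatten_adjacencyMap_apply] at hA
  rw [← flatten_allOnesMap_apply] at hJ
  have hprod : 𝔼 z : Fin t → Fin k → V, ∏ j, X j (z j) = ∏ j, 𝔼 w, X j w := (prod_expect X).symm
  replace hJ : ∏ j, 𝔼 w, X j w = flatten (allOnesMap V k) d x / √n ^ k := hprod ▸ hJ
  have hmean := expect_blocks_mean blk (edgeIndicator H)
  have hmain := abs_expect_mul_prod_sub_le
    (fun z : Fin t → Fin k → V => edgeIndicator H fun q => z (blk q) q) hθ
    (by rw [hmean]; exact hbox) X fun j => (hX2 j).le
  rw [hmean, hJ] at hmain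
  replace hmain : |flatten (adjacencyMap H) d x / √n ^ k -
    (𝔼 v, edgeIndicator H v) * (flatten (allOnesMap V k) d x / √n ^ k)| ≤ t * θ := hA ▸ hmain
  have hpos : 0 < √(n : ℝ) ^ k := by positivity
  constructor
  · rw [← mul_div_assoc, ← sub_div, abs_div, abs_of_pos hpos, div_le_iff₀ hpos] at hmain
    rwa [mul_comm (√(n : ℝ) ^ k)]
  · have h1 : |∏ j, 𝔼 w, X j w| ≤ 1 := by
      rw [Finset.abs_prod]
      exact Finset.prod_le_one (fun _ _ => abs_nonneg _) fun j _ => hX1 j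
    rw [hJ, abs_div, abs_of_pos hpos, div_le_one hpos] at h1
    exact h1

/-- Constant unit vectors give the lower bound for `eig1`. -/
theorem exists_unit_flatten_eq (H : LoopHypergraph V k) (d : Composition k) :
    ∃ x : ∀ i : Fin d.length, EuclideanSpace ℝ (Fin (d.blocksFun i) → V), (∀ i, ‖x i‖ = 1) ∧
      flatten (adjacencyMap H) d x = √(Fintype.card V) ^ k * 𝔼 v, edgeIndicator H v := by
  classical
  set n := Fintype.card V with hn
  have hn0 : (0 : ℝ) < √n := Real.sqrt_pos.mpr (by rw [hn]; exact_mod_cast Fintype.card_pos)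
  refine ⟨fun i => WithLp.toLp 2 fun _ => (√n ^ d.blocksFun i)⁻¹, fun i => ?_, ?_⟩
  · rw [EuclideanSpace.norm_eq, Real.sqrt_eq_one]
    simp only [Real.norm_eq_abs, sq_abs, inv_pow, sqrt_natCast_pow_sq, Finset.sum_const,
      Finset.card_univ, Fintype.card_fun, Fintype.card_fin, nsmul_eq_mul, ← hn, Nat.cast_pow]
    rw [mul_inv_cancel₀]
    rw [← sqrt_natCast_pow_sq]
    positivity
  · rw [flatten_adjacencyMap_apply]
    simp only [Finset.prod_inv_distrib, Finset.prod_pow_eq_pow_sum, d.sum_blocksFun]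
    rw [← Finset.sum_mul, ← Fintype.card_mul_expect, Fintype.card_fun, Fintype.card_fin, ← hn,
      Nat.cast_pow, ← sqrt_natCast_pow_sq]
    field_simp

end Flatten

/-! ### Bounds for a single hypergraph. -/

section PerGraph

open scoped BigOperators

variable {V : Type*} {k m N : ℕ}

theorem edgeIndicator_nonneg (H : LoopHypergraph V k) (v : Fin k → V) : 0 ≤ edgeIndicator H v := by
  unfold edgeIndicator
  split_ifs <;> norm_num

theorem abs_edgeIndicator_le_one (H : LoopHypergraph V k) (v : Fin k → V) :
    |edgeIndicator H v| ≤ 1 := by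
  unfold edgeIndicator
  split_ifs <;> norm_num

variable [Fintype V]

theorem edgeDensity_nonneg (H : LoopHypergraph V k) : 0 ≤ 𝔼 v, edgeIndicator H v :=
  Finset.expect_nonneg fun v _ => edgeIndicator_nonneg H v

variable [Nonempty V]

/-- A Sidorenko-type inequality for the cycle. -/
theorem edgeDensity_pow_le_cycle (H : LoopHypergraph V k) (blk : Fin k → Fin (m + 2))
    (hN : N ≠ 0) : (𝔼 v, edgeIndicator H v) ^ (2 ^ (m + 1) * N) ≤
      𝔼 f : Fin N × (Fin m → Bool) × Fin k → V,
        ∏ i, ∏ s, edgeIndicator H (fun q => f (cyclePlace blk i s q)) := by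
  classical
  have h := mean_pow_le_trace_stepKernel_pow
    (fun z : Fin (m + 2) → Fin k → V => edgeIndicator H fun q => z (blk q) q) N
  rwa [trace_stepKernel_pow_eq_cycle blk _ hN, expect_blocks_mean,
    abs_of_nonneg (edgeDensity_nonneg H), ← pow_mul] at h

theorem boxValue_edgeIndicator_le (H : LoopHypergraph V k) (blk : Fin k → Fin (m + 2))
    (hN : N ≠ 0) {θ : ℝ} (hθ : 0 ≤ θ)
    (h : 𝔼 f : Fin N × (Fin m → Bool) × Fin k → V,
        ∏ i, ∏ s, edgeIndicator H (fun q => f (cyclePlace blk i s q)) ≤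
      (𝔼 v, edgeIndicator H v) ^ (2 ^ (m + 1) * N) + θ ^ N) :
    |boxValue (m + 2) fun z : Fin (m + 2) → Fin k → V => edgeIndicator H fun q => z (blk q) q| ≤
      ((𝔼 v, edgeIndicator H v) ^ 2 ^ (m + 1) + θ) ^ 2 + θ := by
  classical
  have h1 := boxValue_le_of_trace_pow_le
    (fun z : Fin (m + 2) → Fin k → V => edgeIndicator H fun q => z (blk q) q)
    (fun z => abs_edgeIndicator_le_one H _) hN hθ
  rw [trace_stepKernel_pow_eq_cycle blk _ hN, expect_blocks_mean,
    abs_of_nonneg (edgeDensity_nonneg H), ← pow_mul] at h1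
  rw [abs_of_nonneg]
  · exact h1 h
  · rw [boxValue_succ]
    exact Finset.expect_nonneg fun _ _ => sq_nonneg _

theorem abs_factorial_mul_card_div_sub_edgeDensity_le (H : LoopHypergraph V k) :
    |(k.factorial * H.edges.card : ℝ) / (Fintype.card V : ℝ) ^ k - 𝔼 v, edgeIndicator H v| ≤
      (Fintype.card V).ascFactorial k / (Fintype.card V : ℝ) ^ k - 1 := by
  have h := abs_factorial_mul_card_sub_sum_edgeIndicator_le H
  have hpos : (0 : ℝ) < (Fintype.card V : ℝ) ^ k := by positivity
  rw [Fintype.expect_eq_sum_div_card, Fintype.card_fun, Fintype.card_fin, Nat.cast_pow,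
    ← sub_div, abs_div, abs_of_pos hpos, ← div_self hpos.ne', ← sub_div]
  gcongr

/-- The two eigenvalues of a hypergraph whose edge indicator has a small box value. -/
theorem abs_eig_sub_le {t : ℕ} (blk : Fin k → Fin t) (d : Composition k)
    (β : Fin d.length ≃ Fin t) (ρ : Equiv.Perm (Fin k)) (hρ : ∀ q, blk (ρ q) = β (d.index q))
    (H : LoopHypergraph V k) {θ : ℝ} (hθ : 0 ≤ θ)
    (hbox : |boxValue t fun z : Fin t → Fin k → V => edgeIndicator H fun q => z (blk q) q| ≤
      (𝔼 v, edgeIndicator H v) ^ 2 ^ t + θ ^ 2 ^ t) :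
    |eig1 H d - √(Fintype.card V) ^ k * 𝔼 v, edgeIndicator H v| ≤
      √(Fintype.card V) ^ k * (t * θ) ∧
    |eig2 H d| ≤ √(Fintype.card V) ^ k * (t * θ +
      ((Fintype.card V).ascFactorial k / (Fintype.card V : ℝ) ^ k - 1)) := by
  set μ := 𝔼 v, edgeIndicator H v with hμ
  have hμ0 : 0 ≤ μ := edgeDensity_nonneg H
  have hflat := abs_flatten_sub_le blk d β ρ hρ H hθ (by rwa [abs_of_nonneg hμ0])
  rw [← hμ] at hflat
  set s : ℝ := √(Fintype.card V) ^ k with hs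
  have hs0 : 0 ≤ s := by positivity
  have hup : ∀ r ∈ {r : ℝ | ∃ x : ∀ i : Fin d.length,
      EuclideanSpace ℝ (Fin (d.blocksFun i) → V), (∀ i, ‖x i‖ = 1) ∧
        r = |flatten (adjacencyMap H) d x|}, r ≤ s * μ + s * (t * θ) := by
    rintro r ⟨x, hx, rfl⟩
    obtain ⟨h1, h2⟩ := hflat x hx
    have h3 : |μ * flatten (allOnesMap V k) d x| ≤ s * μ := by
      rw [abs_mul, abs_of_nonneg hμ0, mul_comm s]
      gcongr
    have h4 := abs_sub_abs_le_abs_sub (flatten (adjacencyMap H) d x)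
      (μ * flatten (allOnesMap V k) d x)
    linarith
  constructor
  · have h1 : eig1 H d ≤ s * μ + s * (t * θ) := Real.sSup_le hup (by positivity)
    obtain ⟨x, hx, hx'⟩ := exists_unit_flatten_eq H d
    have h2 : s * μ ≤ eig1 H d :=
      le_csSup ⟨_, hup⟩ ⟨x, hx, by rw [hx', abs_of_nonneg (by positivity)]⟩
    rw [abs_of_nonneg (sub_nonneg.mpr h2)]
    linarith
  · have hq := abs_factorial_mul_card_div_sub_edgeDensity_le H
    rw [← hμ] at hq
    set q : ℝ := (k.factorial * H.edges.card : ℝ) / (Fintype.card V : ℝ) ^ k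
    have hasc := (abs_nonneg _).trans hq
    have h0 : 0 ≤ eig2 H d := Real.sSup_nonneg (by rintro r ⟨x, -, rfl⟩; exact abs_nonneg _)
    rw [abs_of_nonneg h0]
    refine Real.sSup_le ?_ (by positivity)
    rintro r ⟨x, hx, rfl⟩
    obtain ⟨h1, h2⟩ := hflat x hx
    -- Passing from `q` to the true mean `μ` costs only the deficit caused by loops.
    have h3 : (flatten (adjacencyMap H) d - q • flatten (allOnesMap V k) d) x =
        (flatten (adjacencyMap H) d x - μ * flatten (allOnesMap V k) d x) -
          (q - μ) * flatten (allOnesMap V k) d x := by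
      rw [sub_apply, smul_apply, smul_eq_mul]
      ring
    rw [h3]
    refine (abs_sub _ _).trans ?_
    rw [mul_add]
    refine add_le_add h1 ?_
    rw [abs_mul, mul_comm]
    gcongr

end PerGraph

/-! ### Error terms in the limit. -/

section Limits

open scoped Topology

theorem tendsto_of_pow_le {p : ℝ} (hp : 0 ≤ p) {D : ℕ} (hD : D ≠ 0) {μ lo r : ℕ → ℝ}
    (hμ : ∀ n, 0 ≤ μ n) (hlo : Tendsto lo atTop (𝓝 p)) (hle : ∀ᶠ n in atTop, lo n ≤ μ n)
    (hr : Tendsto r atTop (𝓝 0)) (hup : ∀ᶠ n in atTop, μ n ^ D ≤ p ^ D + r n) :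
    Tendsto μ atTop (𝓝 p) := by
  have h1 : Tendsto (fun n => (p ^ D + r n) ^ ((D : ℝ)⁻¹)) atTop (𝓝 p) := by
    have h2 : Tendsto (fun n => p ^ D + r n) atTop (𝓝 (p ^ D)) := by
      simpa using tendsto_const_nhds.add hr
    have h3 := h2.rpow_const (p := (D : ℝ)⁻¹) (Or.inr (by positivity))
    rwa [Real.pow_rpow_inv_natCast hp hD] at h3
  refine tendsto_of_tendsto_of_tendsto_of_le_of_le' hlo h1 hle ?_
  filter_upwards [hup] with n hn
  calc μ n = (μ n ^ D) ^ ((D : ℝ)⁻¹) := (Real.pow_rpow_inv_natCast (hμ n) hD).symm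
    _ ≤ _ := by
      have := hμ n
      gcongr

theorem tendsto_rpow_inv_natCast_zero {f : ℕ → ℝ} (hf : Tendsto f atTop (𝓝 0)) {N : ℕ}
    (hN : N ≠ 0) : Tendsto (fun n => f n ^ ((N : ℝ)⁻¹)) atTop (𝓝 0) := by
  have hpos : (0 : ℝ) < (N : ℝ)⁻¹ := by positivity
  have h := hf.rpow_const (p := (N : ℝ)⁻¹) (Or.inr hpos.le)
  rwa [Real.zero_rpow hpos.ne'] at h

/-- Errors in the cycle density become errors in the box value. -/
theorem exists_box_error {p : ℝ} {N E : ℕ} (hN : N ≠ 0) (hE : E ≠ 0) {μ r : ℕ → ℝ}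
    (hμ : ∀ n, 0 ≤ μ n) (hμp : Tendsto μ atTop (𝓝 p)) (hr : Tendsto r atTop (𝓝 0)) :
    ∃ θ η : ℕ → ℝ, (∀ n, 0 ≤ θ n) ∧ (∀ n, 0 ≤ η n) ∧ Tendsto η atTop (𝓝 0) ∧
      (∀ n, p ^ (E * N) + r n ≤ μ n ^ (E * N) + θ n ^ N) ∧
      ∀ n, ((μ n) ^ E + θ n) ^ 2 + θ n = μ n ^ (E * 2) + η n ^ (E * 2) := by
  -- Truncation at `0` makes the `N`-th root legitimate.
  set e : ℕ → ℝ := fun n => max 0 (p ^ (E * N) + r n - μ n ^ (E * N)) with he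
  have he0 : ∀ n, 0 ≤ e n := fun n => le_max_left _ _
  have hetend : Tendsto e atTop (𝓝 0) := by
    have h1 := ((tendsto_const_nhds (x := p ^ (E * N))).add hr).sub (hμp.pow (E * N))
    simpa using (tendsto_const_nhds (x := (0 : ℝ))).max h1
  set θ : ℕ → ℝ := fun n => e n ^ ((N : ℝ)⁻¹) with hθ
  have hθ0 : ∀ n, 0 ≤ θ n := fun n => Real.rpow_nonneg (he0 n) _
  have hθtend : Tendsto θ atTop (𝓝 0) := tendsto_rpow_inv_natCast_zero hetend hN
  set u : ℕ → ℝ := fun n => 2 * μ n ^ E * θ n + θ n ^ 2 + θ n with hu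
  have hu0 : ∀ n, 0 ≤ u n := fun n => by
    have := hμ n
    have := hθ0 n
    positivity
  have hutend : Tendsto u atTop (𝓝 0) := by
    simpa using ((((hμp.pow E).const_mul 2).mul hθtend).add (hθtend.pow 2)).add hθtend
  refine ⟨θ, fun n => u n ^ (((E * 2 : ℕ) : ℝ)⁻¹), hθ0, fun n => Real.rpow_nonneg (hu0 n) _,
    tendsto_rpow_inv_natCast_zero hutend (by positivity), fun n => ?_, fun n => ?_⟩
  · rw [hθ, Real.rpow_inv_natCast_pow (he0 n) hN]
    linarith [le_max_right 0 (p ^ (E * N) + r n - μ n ^ (E * N))]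
  · rw [Real.rpow_inv_natCast_pow (hu0 n) (by positivity), pow_mul, hu]
    ring

end Limits

open scoped BigOperators Topology in
theorem theorem1 {k : ℕ} (p : ℝ) (hp0 : 0 < p) (hp1 : p < 1)
    (V : ℕ → Type*) [∀ n, Fintype (V n)] (hV : ∀ n, Fintype.card (V n) = n)
    (H : ∀ n, LoopHypergraph (V n) k)
    (hE : ∀ n : ℕ, p * (n.choose k : ℝ) ≤ ((H n).edges.card : ℝ))
    (π : Nat.Partition k) (hπ : 2 ≤ π.parts.card)
    (ℓ : ℕ) (hℓ : 1 ≤ ℓ)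
    -- an ordering `c` of `π`, used to form the cycle of length `4 * ℓ`
    (c : Composition k) (hc : Nat.Partition.ofComposition k c = π)
    (hcycle : ∃ g : ℕ → ℝ,
      g =o[atTop] (fun n : ℕ => (n : ℝ) ^ Fintype.card (CycleVertex c (2 * ℓ))) ∧
      ∀ n : ℕ, (((cycleHypergraph c (2 * ℓ)).labeledCopies (H n) : ℕ) : ℝ) ≤
        p ^ (cycleHypergraph c (2 * ℓ)).edges.card *
          (n : ℝ) ^ Fintype.card (CycleVertex c (2 * ℓ)) + g n)
    -- any ordering `d` of `π`, used to form the eigenvalues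
    (d : Composition k) (hd : Nat.Partition.ofComposition k d = π) :
    ((fun n : ℕ => eig1 (H n) d - p * (n : ℝ) ^ ((k : ℝ) / 2))
        =o[atTop] fun n : ℕ => (n : ℝ) ^ ((k : ℝ) / 2)) ∧
    ((fun n : ℕ => eig2 (H n) d) =o[atTop] fun n : ℕ => (n : ℝ) ^ ((k : ℝ) / 2)) := by
  have hlen : 2 ≤ c.length := by
    have h : (c.blocks : Multiset ℕ).card = π.parts.card := by rw [← hc]; rfl
    rw [Multiset.coe_card, c.blocks_length] at h
    omega
  set N := 2 * ℓ with hNdef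
  have hN2 : 2 ≤ N := by omega
  have hN : N ≠ 0 := by omega
  obtain ⟨m, γ, φ, hmodel⟩ := exists_cycle_model c hlen N
  set blk : Fin k → Fin (m + 2) := γ ∘ c.index with hblk
  have hsurj : Function.Surjective blk := γ.surjective.comp fun i =>
    ⟨c.embedding i ⟨0, c.one_le_blocksFun i⟩, c.index_embedding i _⟩
  obtain ⟨β₀, ρ, hρ₀⟩ := exists_perm_of_ofComposition_eq (hc.trans hd.symm)
  set β : Fin d.length ≃ Fin (m + 2) := β₀.trans γ with hβ
  have hρ : ∀ q, blk (ρ q) = β (d.index q) := fun q => congrArg γ (hρ₀ q)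
  obtain ⟨g, hg, hcopies⟩ := hcycle
  set a := Fintype.card (CycleVertex c N) with ha
  have hNe : ∀ n, n ≠ 0 → Nonempty (V n) := fun n hn =>
    Fintype.card_pos_iff.mp (by rw [hV]; omega)
  set μ : ℕ → ℝ := fun n => 𝔼 v, edgeIndicator (H n) v with hμ
  have hμ0 : ∀ n, 0 ≤ μ n := fun n => edgeDensity_nonneg (H n)
  set asc : ℕ → ℝ := fun n => (n.ascFactorial k : ℝ) / (n : ℝ) ^ k - 1 with hasc
  have hasc0 : Tendsto asc atTop (𝓝 0) := by
    simpa using (tendsto_ascFactorial_div_pow k).sub_const 1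
  set r : ℕ → ℝ := fun n => g n / (n : ℝ) ^ a + (1 - (n.descFactorial a : ℝ) / (n : ℝ) ^ a)
    with hr
  have hr0 : Tendsto r atTop (𝓝 0) := by
    simpa using hg.tendsto_div_nhds_zero.add ((tendsto_descFactorial_div_pow a).const_sub 1)
  have hcyc : ∀ n, n ≠ 0 → 𝔼 f : Fin N × (Fin m → Bool) × Fin k → V n,
      ∏ i, ∏ s, edgeIndicator (H n) (fun q => f (cyclePlace blk i s q)) ≤
        p ^ (2 ^ (m + 1) * N) + r n := fun n hn => by
    have := hNe n hn
    have hpos : (0 : ℝ) < (n : ℝ) ^ a := by positivity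
    refine (expect_cycle_le_labeledCopies blk φ hmodel (H n)).trans ?_
    rw [hV, hr, ← add_assoc]
    refine add_le_add_left ?_ _
    rw [div_le_iff₀ hpos, add_mul, div_mul_cancel₀ _ hpos.ne']
    refine (hcopies n).trans ?_
    gcongr ?_ * _ + _
    -- As `p < 1`, a lower bound on the number of edges of the cycle suffices.
    exact pow_le_pow_of_le_one hp0.le hp1.le (card_edges_ge_of_model hsurj hN2 φ hmodel)
  -- The edge count bounds `μ` from below, up to loops; the cycle count bounds it from above.
  have hμp : Tendsto μ atTop (𝓝 p) := by
    have hlo : Tendsto (fun n : ℕ => p * ((n.descFactorial k : ℝ) / (n : ℝ) ^ k) - asc n) atTop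
        (𝓝 p) := by
      simpa using ((tendsto_descFactorial_div_pow k).const_mul p).sub hasc0
    refine tendsto_of_pow_le hp0.le (D := 2 ^ (m + 1) * N) (by positivity) hμ0 hlo ?_ hr0 ?_
    · filter_upwards [eventually_ne_atTop 0] with n hn
      have := hNe n hn
      have h1 := (abs_le.mp (abs_factorial_mul_card_div_sub_edgeDensity_le (H n))).2
      rw [hV] at h1
      have h2 : p * ((n.descFactorial k : ℝ) / (n : ℝ) ^ k) ≤
          (k.factorial * (H n).edges.card : ℝ) / (n : ℝ) ^ k := by
        rw [← mul_div_assoc, Nat.descFactorial_eq_factorial_mul_choose]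
        push_cast
        rw [mul_left_comm]
        gcongr
        exact hE n
      linarith
    · filter_upwards [eventually_ne_atTop 0] with n hn
      have := hNe n hn
      exact (edgeDensity_pow_le_cycle (H n) blk hN).trans (hcyc n hn)
  -- With this `E`, the exponent `E * 2` is `2 ^ (m + 2)`, the number of edges in the box of `m + 2`
  -- variables.
  obtain ⟨θ, η, hθ0, hη0, hη, hθN, hηθ⟩ := exists_box_error (E := 2 ^ (m + 1)) hN (by positivity) hμ0 hμp hr0
  have heig : ∀ n, n ≠ 0 →
      |eig1 (H n) d - √(n : ℝ) ^ k * μ n| ≤ √(n : ℝ) ^ k * ((m + 2 : ℕ) * η n) ∧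
      |eig2 (H n) d| ≤ √(n : ℝ) ^ k * ((m + 2 : ℕ) * η n + asc n) := fun n hn => by
    have := hNe n hn
    have h := abs_eig_sub_le blk d β ρ hρ (H n) (hη0 n) (by
      have h1 := boxValue_edgeIndicator_le (H n) blk hN (hθ0 n) ((hcyc n hn).trans (hθN n))
      rwa [show (𝔼 v, edgeIndicator (H n) v) = μ n from rfl, hηθ, ← pow_succ] at h1)
    rwa [hV] at h
  have hpow : ∀ n : ℕ, (n : ℝ) ^ ((k : ℝ) / 2) = √(n : ℝ) ^ k := fun n => by
    rw [Real.sqrt_eq_rpow, ← Real.rpow_natCast, ← Real.rpow_mul n.cast_nonneg]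
    congr 1
    ring
  simp only [hpow]
  have hbig : ∀ (f e : ℕ → ℝ), Tendsto e atTop (𝓝 0) →
      (∀ n, n ≠ 0 → |f n| ≤ √(n : ℝ) ^ k * e n) → f =o[atTop] fun n : ℕ => √(n : ℝ) ^ k :=
    fun f e he hf => by
      have h1 : f =O[atTop] fun n : ℕ => √(n : ℝ) ^ k * e n := by
        refine IsBigO.of_bound 1 ?_
        filter_upwards [eventually_ne_atTop 0] with n hn
        rw [one_mul, Real.norm_eq_abs, Real.norm_eq_abs]
        exact (hf n hn).trans (le_abs_self _)
      refine h1.trans_isLittleO ?_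
      simpa using (isBigO_refl (fun n : ℕ => √(n : ℝ) ^ k) atTop).mul_isLittleO
        ((isLittleO_one_iff ℝ).mpr he)
  have hη' : Tendsto (fun n => ((m + 2 : ℕ) : ℝ) * η n) atTop (𝓝 0) := by
    simpa using hη.const_mul ((m + 2 : ℕ) : ℝ)
  constructor
  · refine hbig _ (fun n => (m + 2 : ℕ) * η n + |μ n - p|) ?_ fun n hn => ?_
    · have : Tendsto (fun n => |μ n - p|) atTop (𝓝 0) := by
        simpa using (hμp.sub_const p).abs
      simpa using hη'.add this
    · have h1 : eig1 (H n) d - p * √(n : ℝ) ^ k =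
          (eig1 (H n) d - √(n : ℝ) ^ k * μ n) + √(n : ℝ) ^ k * (μ n - p) := by ring
      rw [h1, mul_add]
      refine (abs_add_le _ _).trans (add_le_add (heig n hn).1 ?_)
      rw [abs_mul, abs_of_nonneg (by positivity)]
  · exact hbig _ (fun n => (m + 2 : ℕ) * η n + asc n) (by simpa using hη'.add hasc0)
      fun n hn => (heig n hn).2
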